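/- **Notation.** A $d$-mode tensor $\mathcal T=[t_{i_1,\dots,i_d}]\in\otimes^d\mathbb R^n$ is paired with vectors by $\langle \mathcal T,\mathbf x_1\otimes\cdots\otimes\mathbf x_d\rangle=\sum t_{i_1,\dots,i_d}x_{1,i_1}\cdots x_{d,i_d}$. Put $\|\mathcal T\|_{HS}=(\sum t_{i_1,\dots,i_d}^2)^{1/2}$ and $\|\mathcal T\|_\sigma=\max\{|\langle \mathcal T,\mathbf x_1\otimes\cdots\otimes\mathbf x_d\rangle| : \|\mathbf x_1\|_2=\cdots=\|\mathbf x_d\|_2=1\}$. $\mathrm S^d\mathbb R^n$ is the space of symmetric tensors, and $\mathbb R^n\otimes\mathrm S^p\mathbb R^n\subset\otimes^{p+1}\mathbb R^n$ the space of tensors symmetric in the last $p$ indices. A tensor $\mathcal F\in\mathbb R^n\otimes\mathrm S^p\mathbb R^n$ corresponds to the homogeneous polynomial map $\mathbf F:\mathbb R^n\to\mathbb R^n$ of degree $p$, $F_i(\mathbf x)=\sum_{j_1,\dots,j_p} f_{i,j_1,\dots,j_p}x_{j_1}\cdots x_{j_p}$. The iterate $\mathcal F^{\circ k}\in\mathbb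 R^n\otimes\mathrm S^{p^k}\mathbb R^n$ is the tensor corresponding to the $k$-fold iterate $\mathbf F^{\circ k}$. For a polynomial map $\mathbf G$ with homogeneous components, $\|\mathbf G\|_{HS}=(\sum_i\|G_i\|_{HS}^2)^{1/2}$, where $\|G_i\|_{HS}$ is the Hilbert–Schmidt norm of the symmetric tensor of $G_i$. For a form $f$, $\|f\|_\sigma=\max_{\|\mathbf x\|_2=1}|f(\mathbf x)|$; a form $f$ of degree $q$ is orthogonally diagonalizable if $f(Q\mathbf x)=\sum_i\lambda_i x_i^q$ for some orthogonal matrix $Q$ and real $\lambda_i$. **Theorem.** Let $p\ge 2$ be an integer and let $\mathcal F\in\mathbb R^n\otimes\mathrm S^p\mathbb R^n$ be nonzero, with polynomial map $\mathbf F$. Below, $k,l,m$ are integers $\ge1$ except where stated otherwise. *Rank-one case.* If $\mathcal F=a\otimes^{p+1}\mathbf a$ with $\|\mathbf a\|_2=1$, $a\neq0$, then for all $k$ $$\mathcal F^{\circ k}=a^{(p^k-1)/(p-1)}\otimes^{p^k+1}\mathbf a,\qquad \mathbf F^{\circ k}(\mathbf x)=a^{(p^k-1)/(p-1)}(\mathbf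 a^\top\mathbf x)^{p^k}\mathbf a,$$ $$\|\mathcal F^{\circ k}\|_{HS}=\|\mathbf F^{\circ k}\|_{HS}=|a|^{(p^k-1)/(p-1)}.$$ (a) Put $f_k=\|\mathcal F^{\circ k}\|_{HS}^{(p-1)/(p^k-1)}$. Then $f_k\le\|\mathcal F\|_{HS}$ for all $k$; $$\|\mathcal F^{\circ(k+l)}\|_{HS}\le\|\mathcal F^{\circ k}\|_{HS}\,\|\mathcal F^{\circ l}\|_{HS}^{p^k}\quad\text{for all }k,l;\tag{1}$$ for each fixed $m$ the sequence $f_{m2^l}$, $l=0,1,\dots$, is nonincreasing; and the limit $\rho_2=\lim_{k\to\infty}f_k$ exists in $\mathbb R$. If moreover $\mathcal F$ is not of the rank-one form above, then for all $k,l$ equality holds in (1) if and only if either $\mathcal F^{\circ k}=0$, or $\mathcal F^{\circ l}=0$, or $\min(k,l)\ge2$ and there are $\mathbf a\in\mathbb R^n$ with $\|\mathbf a\|_2=1$ and $b,c\in\mathbb R$ such that $\mathcal F^{\circ k}=b\otimes^{p^k+1}\mathbf a$, $\mathcal F^{\circ l}=c\otimes^{p^l+1}\mathbf a$ and $bc^{p^k}=cb^{p^l}$.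 (b) Put $\tilde f_k=\|\mathcal F^{\circ k}\|_\sigma^{(p-1)/(p^k-1)}$. Then $\tilde f_k\le\|\mathcal F\|_\sigma$ for all $k$; $$\|\mathcal F^{\circ(k+l)}\|_\sigma\le\|\mathcal F^{\circ k}\|_\sigma\,\|\mathcal F^{\circ l}\|_\sigma^{p^k}\quad\text{for all }k,l;\tag{2}$$ for each fixed $m$ the sequence $\tilde f_{m2^l}$, $l=0,1,\dots$, is nonincreasing; the limit $\rho_3=\lim_{k\to\infty}\tilde f_k$ exists in $\mathbb R$; and $\rho_3\le\rho_2$. For all $k,l$ equality holds in (2) if and only if either $\mathcal F^{\circ l}=0$ or there is $\mathbf x^\star$ with $\|\mathbf x^\star\|_2=1$, $\|\mathbf F^{\circ l}(\mathbf x^\star)\|_2=\|\mathcal F^{\circ l}\|_\sigma$ and $\|\mathbf F^{\circ k}(\mathbf y)\|_2=\|\mathcal F^{\circ k}\|_\sigma$, where $\mathbf y=\|\mathcal F^{\circ l}\|_\sigma^{-1}\mathbf F^{\circ l}(\mathbf x^\star)$. (c) Suppose $\mathcal F\in\mathrm S^{p+1}\mathbb R^n$ and let $f(\mathbf x)=\langle\mathcal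 F,\otimes^{p+1}\mathbf x\rangle$. Then $\mathbf F=\frac1{p+1}\nabla f$ and $$\|f\|_\sigma=\|\mathcal F\|_\sigma=\rho_3\le\rho_2,$$ and $\|f\|_\sigma=\rho_2$ if $f$ is orthogonally diagonalizable. -/

import Mathlib

open scoped Nat Topology
open Filter

namespace HomTensor

noncomputable section

/-- `ℝⁿ` with the Euclidean norm. -/
abbrev Vec (n : ℕ) : Type := EuclideanSpace ℝ (Fin n)

/-- `⊗ᵈ ℝⁿ`: real `d`-mode tensors `[t_{i₁,…,i_d}]` in coordinates. -/
abbrev Tensor (n d : ℕ) : Type := (Fin d → Fin n) → ℝ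

variable {n d p q : ℕ}

/-- `⟨T, x₁ ⊗ ⋯ ⊗ x_d⟩`. -/
def pairing (T : Tensor n d) (x : Fin d → Vec n) : ℝ :=
  ∑ i, T i * ∏ s, x s (i s)

/-- The rank-one tensor `⊗ᵈ v`. -/
def tpow (d : ℕ) (v : Vec n) : Tensor n d := fun i => ∏ s, v (i s)

/-- The Hilbert-Schmidt norm of a tensor. -/
def hsNorm (T : Tensor n d) : ℝ := √(∑ i, T i ^ 2)

/-- The spectral norm of a tensor: the maximum of `|⟨T, x₁ ⊗ ⋯ ⊗ x_d⟩|` over unit vectors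
`x₁, …, x_d` (independent of each other). -/
def specNorm (T : Tensor n d) : ℝ :=
  sSup {r | ∃ x : Fin d → Vec n, (∀ s, ‖x s‖ = 1) ∧ r = |pairing T x|}

/-- `T ∈ Sᵈ ℝⁿ`. -/
def IsSymm (T : Tensor n d) : Prop :=
  ∀ (σ : Equiv.Perm (Fin d)) (i : Fin d → Fin n), T (i ∘ σ) = T i

/-- `T ∈ ℝⁿ ⊗ Sᵖ ℝⁿ`: symmetric in the last `p` indices. -/
def IsPartSymm (T : Tensor n (p + 1)) : Prop :=
  ∀ (σ : Equiv.Perm (Fin p)) (i : Fin n) (j : Fin p → Fin n),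
    T (Fin.cons i (j ∘ σ)) = T (Fin.cons i j)

/-- The form `f(x) = ⟨T, ⊗ᵈ x⟩`. -/
def form (T : Tensor n d) (x : Vec n) : ℝ := pairing T fun _ => x

/-- The map `x ↦ T × ⊗ᵖ x`, i.e. `F_i(x) = ∑ t_{i,j₁,…,j_p} x_{j₁} ⋯ x_{j_p}`. -/
def toMap (T : Tensor n (p + 1)) (x : Vec n) : Vec n :=
  WithLp.toLp 2 fun i => ∑ j : Fin p → Fin n, T (Fin.cons i j) * ∏ s, x (j s)

/-- Partial symmetrization with respect to the last `p` indices. -/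
def psym (T : Tensor n (p + 1)) : Tensor n (p + 1) := fun i =>
  (p ! : ℝ)⁻¹ * ∑ σ : Equiv.Perm (Fin p), T (Fin.cons (i 0) (Fin.tail i ∘ σ))

/-- The composition tensor `G ∘ F ∈ ℝⁿ ⊗ S^{qp} ℝⁿ`: each of the last `q` indices of `G` is
contracted with the first index of a copy of `F`, and the result is symmetrized in the
`q * p` remaining indices.  See `toMap_comp` and `isPartSymm_comp`. -/
def comp (G : Tensor n (q + 1)) (F : Tensor n (p + 1)) : Tensor n (q * p + 1) :=
  psym fun i => ∑ k : Fin q → Fin n, G (Fin.cons (i 0) k) *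
    ∏ s : Fin q, F (Fin.cons (k s) fun t : Fin p => Fin.tail i (finProdFinEquiv (s, t)))

/-- The iterates `F^{∘k} ∈ ℝⁿ ⊗ S^{p^k} ℝⁿ`; `F^{∘0}` is the identity matrix. -/
def iter (F : Tensor n (p + 1)) : (k : ℕ) → Tensor n (p ^ k + 1)
  | 0 => fun i : Fin (1 + 1) → Fin n => if i 0 = i 1 then 1 else 0
  | k + 1 => (comp (iter F k) F : Tensor n (p ^ k * p + 1))

/-- The exponent `(p - 1) / (p^k - 1)`, used for `k ≥ 1`. -/
def normExp (p k : ℕ) : ℝ := ((p : ℝ) - 1) / ((p : ℝ) ^ k - 1)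

/-- `‖F^{∘k}‖_HS ^ ((p-1)/(p^k-1))`. -/
def hsSeq (F : Tensor n (p + 1)) (k : ℕ) : ℝ := hsNorm (iter F k) ^ normExp p k

/-- `‖F^{∘k}‖_σ ^ ((p-1)/(p^k-1))`. -/
def specSeq (F : Tensor n (p + 1)) (k : ℕ) : ℝ := specNorm (iter F k) ^ normExp p k

/-- The maximum of `|f|` on the unit sphere. -/
def formNorm (f : Vec n → ℝ) : ℝ := sSup {r | ∃ x : Vec n, ‖x‖ = 1 ∧ r = |f x|}

/-- `f(Qx) = ∑ λ_i x_i^q` for some orthogonal matrix `Q` and reals `λ_i`. -/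
def OrthDiag (q : ℕ) (f : Vec n → ℝ) : Prop :=
  ∃ Q ∈ Matrix.orthogonalGroup (Fin n) ℝ, ∃ c : Fin n → ℝ,
    ∀ x : Vec n, f (Matrix.toEuclideanLin Q x) = ∑ i, c i * x i ^ q

/-- The polynomial map (tuple of polynomials) of the tensor `T`. -/
def polyMap (T : Tensor n (p + 1)) : Fin n → MvPolynomial (Fin n) ℝ := fun i =>
  ∑ j : Fin p → Fin n, MvPolynomial.C (T (Fin.cons i j)) * ∏ s, MvPolynomial.X (j s)

/-- The `k`-th iterate of a polynomial map, by substitution of polynomials. -/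
def polyIter (P : Fin n → MvPolynomial (Fin n) ℝ) : ℕ → Fin n → MvPolynomial (Fin n) ℝ
  | 0 => MvPolynomial.X
  | k + 1 => fun i => MvPolynomial.bind₁ P (polyIter P k i)

/-- The exponent of the monomial `x_{i₁} ⋯ x_{i_d}`. -/
def expo (i : Fin d → Fin n) : Fin n →₀ ℕ := ∑ s, Finsupp.single (i s) 1

/-- The symmetric tensor of a homogeneous polynomial `f` of degree `d`: its entry at
`(i₁,…,i_d)` is the coefficient of `x_{i₁} ⋯ x_{i_d} = x₁^{j₁} ⋯ x_n^{j_n}` in `f`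
divided by `d! / (j₁! ⋯ j_n!)`. -/
def polyTensor (d : ℕ) (f : MvPolynomial (Fin n) ℝ) : Tensor n d := fun i =>
  MvPolynomial.coeff (expo i) f * (∏ t, ((expo i t)! : ℝ)) / (d ! : ℝ)

/-- `√(∑ ‖F_i‖²_HS)` for a map whose components `F_i` are homogeneous polynomials of
degree `d`, where `‖F_i‖_HS` is the norm of the symmetric tensor of `F_i`. -/
def polyMapHS (d : ℕ) (P : Fin n → MvPolynomial (Fin n) ℝ) : ℝ :=
  √(∑ i, hsNorm (polyTensor d (P i)) ^ 2)

theorem isPartSymm_psym (T : Tensor n (p + 1)) : IsPartSymm (psym T) := by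
  intro σ i j
  simp only [psym, Fin.cons_zero, Fin.tail_cons]
  congr 1
  exact Fintype.sum_equiv (Equiv.mulLeft σ) _ _ fun τ => rfl

theorem isPartSymm_comp (G : Tensor n (q + 1)) (F : Tensor n (p + 1)) :
    IsPartSymm (comp G F) := isPartSymm_psym _

theorem toMap_psym (T : Tensor n (p + 1)) : toMap (psym T) = toMap T := by
  funext x
  ext i
  simp only [toMap, psym, Fin.cons_zero, Fin.tail_cons, mul_assoc, Finset.sum_mul,
    ← Finset.mul_sum]
  rw [Finset.sum_comm]
  have h : ∀ σ : Equiv.Perm (Fin p),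
      ∑ j : Fin p → Fin n, T (Fin.cons i (j ∘ σ)) * ∏ s, x (j s)
        = ∑ j : Fin p → Fin n, T (Fin.cons i j) * ∏ s, x (j s) := by
    intro σ
    refine Fintype.sum_equiv (σ.symm.arrowCongr (Equiv.refl _)) _ _ fun j => ?_
    have h1 : (σ.symm.arrowCongr (Equiv.refl (Fin n))) j = j ∘ σ := by
      funext s; simp [Equiv.arrowCongr]
    rw [h1]
    congr 1
    exact (Equiv.prod_comp σ fun s => x (j s)).symm
  rw [Finset.sum_congr rfl fun σ _ => h σ, Finset.sum_const, Finset.card_univ,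
    Fintype.card_perm, Fintype.card_fin, nsmul_eq_mul, ← mul_assoc,
    inv_mul_cancel₀ (by exact_mod_cast Nat.factorial_ne_zero p), one_mul]

/-- The composition tensor represents the composition of the maps. -/
theorem toMap_comp (G : Tensor n (q + 1)) (F : Tensor n (p + 1)) :
    toMap (comp G F) = toMap G ∘ toMap F := by
  rw [comp, toMap_psym]
  funext x
  ext i
  simp only [toMap, Function.comp, Fin.cons_zero, Fin.tail_cons, Finset.sum_mul]
  rw [Finset.sum_comm]
  refine Finset.sum_congr rfl fun k _ => ?_
  rw [Finset.prod_univ_sum, Finset.mul_sum, Fintype.piFinset_univ]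
  refine Fintype.sum_equiv ((finProdFinEquiv.symm.arrowCongr (Equiv.refl (Fin n))).trans
    (Equiv.curry (Fin q) (Fin p) (Fin n))) _ _ fun j => ?_
  rw [mul_assoc, Finset.prod_mul_distrib]
  congr 2
  rw [← Equiv.prod_comp finProdFinEquiv, Fintype.prod_prod_type]
  rfl

/-- The iterated tensor represents the iterated map. -/
theorem toMap_iter (F : Tensor n (p + 1)) (k : ℕ) : toMap (iter F k) = (toMap F)^[k] := by
  induction k with
  | zero =>
    funext x
    ext i
    have h : ∑ j : Fin 1 → Fin n, (if i = j 0 then (1 : ℝ) else 0) * ∏ s, x (j s) = x i := by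
      rw [← Equiv.sum_comp (Equiv.funUnique (Fin 1) (Fin n)).symm]
      simp
    exact h
  | succ k ih =>
    rw [Function.iterate_succ, ← ih]
    exact toMap_comp (iter F k) F

end

end HomTensor

open HomTensor

/-! A tensor symmetric in its last indices is determined by its polynomial map
(`IsPartSymm.ext_toMap`), so `iter F (k + l)` has the norms of the composition of `iter F k` with
`iter F l`. For the Hilbert-Schmidt norm, composition is a contraction, bounded by Cauchy-Schwarz,
followed by symmetrization, which is an orthogonal projection. For the spectral norm, Banach's
theorem (`exists_diag_max`) gives `‖T‖_σ = max ‖toMap T x‖` over the unit sphere, and homogeneity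
does the rest. Either way `N (k + l) ≤ N k * N l ^ p ^ k`.

With `e k = (p ^ k - 1) / (p - 1) = 1 + p + ⋯ + p ^ (k - 1)` one has `e (k + l) = e k + p ^ k * e
l`, so a Fekete argument gives convergence of `N k ^ (1 / e k)`.

Equality in (1) forces equality in every Cauchy-Schwarz step, so nonzero iterates split as `g ⊗ u^q`
and `u ⊗ w`. Since iterates commute, `g` is parallel to `u` and `w` is a multiple of `u^p`
(`exists_tpow_of_hsNorm_comp_eq`).

For symmetric `F`, a unit maximizer `u` of `|f|` satisfies `F(u) = f(u) u`; its orbit bounds the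
spectral norms of the iterates from below, so `specSeq F` is constant for `k ≥ 1`. For
diagonalizable `f` the two norms of an iterate differ by a factor of at most `√n`, which disappears
in the limit of roots. -/

namespace HomTensor

noncomputable section

/-! ### Symmetric tensors, their forms and maps, and the Hilbert-Schmidt norm. -/

section Symmetric

variable {n d p q : ℕ}

/-- The polynomial function of a tensor, as a polynomial. -/
def formPoly (T : Tensor n d) : MvPolynomial (Fin n) ℝ :=
  ∑ i, MvPolynomial.C (T i) * ∏ s, MvPolynomial.X (i s)

theorem eval_formPoly (T : Tensor n d) (x : Vec n) :
    MvPolynomial.eval (fun t => x t) (formPoly T) = form T x := by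
  simp [formPoly, form, pairing]

theorem prod_X_eq_monomial_expo (i : Fin d → Fin n) :
    (∏ s, MvPolynomial.X (i s) : MvPolynomial (Fin n) ℝ) = MvPolynomial.monomial (expo i) 1 := by
  rw [expo, MvPolynomial.monomial_sum_one]
  rfl

theorem expo_apply (i : Fin d → Fin n) (t : Fin n) :
    expo i t = Fintype.card {s // i s = t} := by
  rw [Fintype.card_subtype, Finset.card_filter]
  simp [expo, Finsupp.single_apply]

/-- The fibres of `i` and `j` over each value have equal size; bijections between these fibres glue
to a permutation. -/
theorem exists_perm_of_expo_eq {i j : Fin d → Fin n} (h : expo j = expo i) :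
    ∃ σ : Equiv.Perm (Fin d), j = i ∘ σ := by
  have e : ∀ t, Nonempty ({s // j s = t} ≃ {s // i s = t}) := fun t =>
    ⟨Fintype.equivOfCardEq (by rw [← expo_apply, ← expo_apply, h])⟩
  have e := fun t => (e t).some
  refine ⟨(Equiv.sigmaFiberEquiv j).symm.trans
    ((Equiv.sigmaCongrRight e).trans (Equiv.sigmaFiberEquiv i)), ?_⟩
  funext s
  exact ((e (j s)) ⟨s, rfl⟩).2.symm

/-- The coefficient of `formPoly T` at `expo i` sums `T` over the rearrangements of `i`, where `T`
is constant; it is thus a nonzero multiple of `T i`. -/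
theorem IsSymm.eq_zero_of_form_eq_zero {T : Tensor n d} (hT : IsSymm T)
    (h : ∀ x, form T x = 0) : T = 0 := by
  have hP : formPoly T = 0 := by
    refine MvPolynomial.funext fun x => ?_
    rw [map_zero, ← h (WithLp.toLp 2 x), ← eval_formPoly]
  refine funext fun i => ?_
  change T i = 0
  have hc : MvPolynomial.coeff (expo i) (formPoly T) = 0 := by rw [hP]; simp
  have hc' : ∑ j, (if expo j = expo i then T j else 0) = 0 := by
    refine Eq.trans ?_ hc
    rw [formPoly, MvPolynomial.coeff_sum]
    refine Finset.sum_congr rfl fun j _ => ?_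
    rw [prod_X_eq_monomial_expo, MvPolynomial.coeff_C_mul, MvPolynomial.coeff_monomial]
    simp
  have hc'' : ∑ j, (if expo j = expo i then T j else 0)
      = ∑ j : Fin d → Fin n, (if expo j = expo i then T i else 0) := by
    refine Finset.sum_congr rfl fun j _ => ?_
    split_ifs with hj
    · obtain ⟨σ, rfl⟩ := exists_perm_of_expo_eq hj
      exact hT σ i
    · rfl
  rw [hc'', ← Finset.sum_filter, Finset.sum_const, nsmul_eq_mul] at hc'
  rcases mul_eq_zero.1 hc' with h0 | h0
  · have : (Finset.univ.filter fun j : Fin d → Fin n => expo j = expo i).card ≠ 0 :=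
      Finset.card_ne_zero.2 ⟨i, by simp⟩
    exact absurd (by exact_mod_cast h0) this
  · exact h0

theorem form_sub (S T : Tensor n d) (x : Vec n) : form (S - T) x = form S x - form T x := by
  simp [form, pairing, sub_mul]

theorem IsSymm.sub {S T : Tensor n d} (hS : IsSymm S) (hT : IsSymm T) : IsSymm (S - T) :=
  fun σ i => by simp [hS σ i, hT σ i]

theorem IsSymm.ext_form {S T : Tensor n d} (hS : IsSymm S) (hT : IsSymm T)
    (h : ∀ x, form S x = form T x) : S = T :=
  sub_eq_zero.1 ((hS.sub hT).eq_zero_of_form_eq_zero fun x => by simp [form_sub, h x])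

/-- The symmetric tensor obtained by fixing the first index. -/
def slice (T : Tensor n (p + 1)) (i : Fin n) : Tensor n p := fun j => T (Fin.cons i j)

theorem toMap_apply (T : Tensor n (p + 1)) (x : Vec n) (i : Fin n) :
    toMap T x i = form (slice T i) x := rfl

theorem IsPartSymm.isSymm_slice {T : Tensor n (p + 1)} (hT : IsPartSymm T) (i : Fin n) :
    IsSymm (slice T i) := fun σ j => hT σ i j

theorem IsPartSymm.ext_toMap {S T : Tensor n (p + 1)} (hS : IsPartSymm S) (hT : IsPartSymm T)
    (h : ∀ x, toMap S x = toMap T x) : S = T := by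
  have : ∀ i, slice S i = slice T i := fun i =>
    (hS.isSymm_slice i).ext_form (hT.isSymm_slice i) fun x => by
      rw [← toMap_apply, ← toMap_apply, h x]
  funext i
  have := congrFun (this (i 0)) (Fin.tail i)
  simpa [slice, Fin.cons_self_tail] using this

theorem IsPartSymm.zero : IsPartSymm (0 : Tensor n (p + 1)) := fun _ _ _ => rfl

theorem toMap_zero_tensor (x : Vec n) : toMap (0 : Tensor n (p + 1)) x = 0 := by
  ext i; simp [toMap]

theorem IsSymm.isPartSymm {T : Tensor n (p + 1)} (hT : IsSymm T) : IsPartSymm T := by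
  intro σ i j
  have h := hT (Equiv.Perm.decomposeFin.symm (0, σ)) (Fin.cons i j)
  rw [← h]
  congr 1
  funext s
  refine Fin.cases ?_ (fun s => ?_) s <;> simp

theorem isPartSymm_iter (F : Tensor n (p + 1)) (k : ℕ) : IsPartSymm (iter F k) := by
  cases k with
  | zero =>
    intro σ i j
    have : σ = 1 := by
      ext s
      have := (σ s).2
      have := s.2
      simp only [pow_zero] at *
      simp
    rw [this]; rfl
  | succ k => exact isPartSymm_comp _ _

theorem tpow_isSymm (v : Vec n) : IsSymm (tpow d v) := fun σ i =>
  Equiv.prod_comp σ fun s => v (i s)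

theorem IsSymm.smul {T : Tensor n d} (hT : IsSymm T) (a : ℝ) : IsSymm (a • T) :=
  fun σ i => by simp [hT σ i]

theorem IsSymm.sum {ι : Type*} {s : Finset ι} {T : ι → Tensor n d} (hT : ∀ i, IsSymm (T i)) :
    IsSymm (∑ i ∈ s, T i) :=
  fun σ j => by simp [Finset.sum_apply, hT _ σ j]

theorem inner_eq_sum (x y : Vec n) : inner ℝ x y = ∑ i, x i * y i := by
  simp [PiLp.inner_apply, mul_comm]

theorem pairing_tpow (v : Vec n) (x : Fin d → Vec n) :
    pairing (tpow d v) x = ∏ s, inner ℝ v (x s) := by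
  simp only [pairing, tpow, inner_eq_sum, ← Finset.prod_mul_distrib, Finset.prod_univ_sum,
    Fintype.piFinset_univ]

theorem form_tpow (v x : Vec n) : form (tpow d v) x = inner ℝ v x ^ d := by
  simp [form, pairing_tpow]

theorem pairing_smul (a : ℝ) (T : Tensor n d) (x : Fin d → Vec n) :
    pairing (a • T) x = a * pairing T x := by
  simp [pairing, Finset.mul_sum, mul_assoc]

theorem pairing_sum {ι : Type*} (s : Finset ι) (T : ι → Tensor n d) (x : Fin d → Vec n) :
    pairing (∑ i ∈ s, T i) x = ∑ i ∈ s, pairing (T i) x := by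
  simp only [pairing, Finset.sum_apply, Finset.sum_mul]
  exact Finset.sum_comm

theorem slice_tpow (v : Vec n) (i : Fin n) : slice (tpow (p + 1) v) i = v i • tpow p v := by
  funext j
  simp [slice, tpow, Fin.prod_univ_succ]

theorem toMap_tpow (v x : Vec n) : toMap (tpow (p + 1) v) x = inner ℝ v x ^ p • v := by
  ext i
  rw [toMap_apply, slice_tpow, form, pairing_smul, ← form, form_tpow]
  simp [mul_comm]

theorem toMap_smul_tensor (a : ℝ) (T : Tensor n (p + 1)) (x : Vec n) :
    toMap (a • T) x = a • toMap T x := by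
  ext i
  simp [toMap, Finset.mul_sum, mul_assoc]

theorem toMap_sum {ι : Type*} (s : Finset ι) (T : ι → Tensor n (p + 1)) (x : Vec n) :
    toMap (∑ i ∈ s, T i) x = ∑ i ∈ s, toMap (T i) x := by
  ext i
  simp only [toMap, Finset.sum_apply, Finset.sum_mul, WithLp.ofLp_sum]
  exact Finset.sum_comm

theorem form_smul_vec (T : Tensor n d) (a : ℝ) (x : Vec n) : form T (a • x) = a ^ d * form T x := by
  simp only [form, pairing, PiLp.smul_apply, smul_eq_mul, Finset.prod_mul_distrib,
    Finset.prod_const, Finset.card_univ, Fintype.card_fin, Finset.mul_sum]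
  exact Finset.sum_congr rfl fun i _ => by ring

theorem toMap_smul_vec (T : Tensor n (p + 1)) (a : ℝ) (x : Vec n) :
    toMap T (a • x) = a ^ p • toMap T x := by
  ext i
  simp [toMap_apply, form_smul_vec]

theorem sum_cons {M : Type*} [AddCommMonoid M] (g : (Fin (p + 1) → Fin n) → M) :
    ∑ i, g i = ∑ a, ∑ j : Fin p → Fin n, g (Fin.cons a j) := by
  rw [← (Fin.consEquiv fun _ => Fin n).sum_comp, Fintype.sum_prod_type]
  rfl

theorem inner_toMap (T : Tensor n (p + 1)) (x y : Vec n) :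
    inner ℝ y (toMap T x) = pairing T (Fin.cons y fun _ => x) := by
  simp only [inner_eq_sum, pairing, sum_cons, toMap, Finset.mul_sum, Fin.prod_univ_succ,
    Fin.cons_zero, Fin.cons_succ]
  exact Finset.sum_congr rfl fun a _ => Finset.sum_congr rfl fun j _ => by ring

theorem pairing_cons (T : Tensor n (p + 1)) (y : Vec n) (x : Fin p → Vec n) :
    pairing T (Fin.cons y x) = pairing (fun j => ∑ i, y i * T (Fin.cons i j)) x := by
  simp only [pairing, sum_cons, Fin.prod_univ_succ, Fin.cons_zero, Fin.cons_succ, Finset.sum_mul]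
  rw [Finset.sum_comm]
  exact Finset.sum_congr rfl fun a _ => Finset.sum_congr rfl fun j _ => by ring

theorem inner_toMap_self (T : Tensor n (p + 1)) (x : Vec n) :
    inner ℝ x (toMap T x) = form T x := by
  rw [inner_toMap, form]
  congr 1
  funext s
  refine Fin.cases ?_ (fun s => ?_) s <;> simp

/-- `⟨T, x₁ ⊗ ⋯ ⊗ x_d⟩` as a continuous multilinear map. -/
def pairingMap (T : Tensor n d) : ContinuousMultilinearMap ℝ (fun _ : Fin d => Vec n) ℝ where
  toFun := pairing T
  map_update_add' x s a b := by
    have h : ∀ (c : Vec n) (i : Fin d → Fin n),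
        ∏ t, Function.update x s c t (i t) = c (i s) * ∏ t ∈ Finset.univ.erase s, x t (i t) := by
      intro c i
      rw [← Finset.mul_prod_erase _ _ (Finset.mem_univ s)]
      simp only [Function.update_self]
      congr 1
      exact Finset.prod_congr rfl fun t ht => by
        rw [Function.update_of_ne (Finset.ne_of_mem_erase ht)]
    -- The structure field quantifies over the decidability instance, which must be identified with
    -- the one used in `h`.
    have e : ‹DecidableEq (Fin d)› = instDecidableEqFin d := Subsingleton.elim _ _
    subst e
    simp only [pairing, h, PiLp.add_apply, add_mul, mul_add, Finset.sum_add_distrib]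
  map_update_smul' x s c a := by
    have h : ∀ (c : Vec n) (i : Fin d → Fin n),
        ∏ t, Function.update x s c t (i t) = c (i s) * ∏ t ∈ Finset.univ.erase s, x t (i t) := by
      intro c i
      rw [← Finset.mul_prod_erase _ _ (Finset.mem_univ s)]
      simp only [Function.update_self]
      congr 1
      exact Finset.prod_congr rfl fun t ht => by
        rw [Function.update_of_ne (Finset.ne_of_mem_erase ht)]
    have e : ‹DecidableEq (Fin d)› = instDecidableEqFin d := Subsingleton.elim _ _
    subst e
    simp only [pairing, h, PiLp.smul_apply, smul_eq_mul, Finset.mul_sum]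
    exact Finset.sum_congr rfl fun i _ => by ring
  cont := by
    change Continuous fun x : Fin d → Vec n => ∑ i, T i * ∏ s, x s (i s)
    fun_prop

@[simp] theorem pairingMap_apply (T : Tensor n d) (x : Fin d → Vec n) :
    pairingMap T x = pairing T x := rfl

theorem IsSymm.pairing_comp {T : Tensor n d} (hT : IsSymm T) (σ : Equiv.Perm (Fin d))
    (x : Fin d → Vec n) : pairing T (x ∘ σ) = pairing T x := by
  simp only [pairing]
  refine Fintype.sum_equiv (σ.arrowCongr (Equiv.refl _)) _ _ fun i => ?_
  have h1 : (σ.arrowCongr (Equiv.refl (Fin n))) i = i ∘ σ.symm := by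
    funext s; simp [Equiv.arrowCongr]
  rw [h1, hT]
  congr 1
  rw [← Equiv.prod_comp σ fun s => x s ((i ∘ σ.symm) s)]
  simp

theorem hsNorm_nonneg (T : Tensor n d) : 0 ≤ hsNorm T := Real.sqrt_nonneg _

theorem hsNorm_sq (T : Tensor n d) : hsNorm T ^ 2 = ∑ i, T i ^ 2 :=
  Real.sq_sqrt (Finset.sum_nonneg fun _ _ => sq_nonneg _)

theorem hsNorm_eq_zero {T : Tensor n d} : hsNorm T = 0 ↔ T = 0 := by
  rw [← sq_eq_zero_iff, hsNorm_sq, Finset.sum_eq_zero_iff_of_nonneg fun _ _ => sq_nonneg _]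
  simp [funext_iff]

/-- Cauchy-Schwarz against a rank-one tensor, whose Hilbert-Schmidt norm is the product of the norms
of its factors. -/
theorem abs_pairing_le (T : Tensor n d) (x : Fin d → Vec n) :
    |pairing T x| ≤ hsNorm T * ∏ s, ‖x s‖ := by
  refine abs_le_of_sq_le_sq ?_
    (mul_nonneg (hsNorm_nonneg _) (Finset.prod_nonneg fun _ _ => norm_nonneg _))
  rw [mul_pow, hsNorm_sq, ← Finset.prod_pow]
  have h : ∏ s, ‖x s‖ ^ 2 = ∑ i : Fin d → Fin n, (∏ s, x s (i s)) ^ 2 := by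
    simp only [EuclideanSpace.real_norm_sq_eq, Finset.prod_univ_sum, Fintype.piFinset_univ,
      Finset.prod_pow]
  rw [h]
  exact Finset.sum_mul_sq_le_sq_mul_sq _ _ _

theorem hsNorm_smul (a : ℝ) (T : Tensor n d) : hsNorm (a • T) = |a| * hsNorm T := by
  rw [← sq_eq_sq₀ (hsNorm_nonneg _) (mul_nonneg (abs_nonneg _) (hsNorm_nonneg _)), mul_pow,
    hsNorm_sq, hsNorm_sq, sq_abs, Finset.mul_sum]
  simp [mul_pow]

/-- The tensors `tpow d (v i)` have inner products `⟨v i, v j⟩ ^ d`, hence are orthonormal for `d ≠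
0`. -/
theorem hsNorm_sum_tpow {ι : Type*} [Fintype ι] (b : ι → ℝ) {v : ι → Vec n}
    (hv : Orthonormal ℝ v) (hd : d ≠ 0) :
    hsNorm (∑ i, b i • tpow d (v i)) ^ 2 = ∑ i, b i ^ 2 := by
  classical
  have h1 : hsNorm (∑ i, b i • tpow d (v i)) ^ 2
      = ∑ i, ∑ j, b i * b j * ∑ k, tpow d (v i) k * tpow d (v j) k := by
    rw [hsNorm_sq]
    simp_rw [Finset.sum_apply, Pi.smul_apply, smul_eq_mul, sq, Finset.sum_mul_sum,
      Finset.mul_sum]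
    rw [Finset.sum_comm]
    refine Finset.sum_congr rfl fun i _ => ?_
    rw [Finset.sum_comm]
    exact Finset.sum_congr rfl fun j _ => Finset.sum_congr rfl fun k _ => by ring
  rw [h1]
  have h2 : ∀ i j, ∑ k, tpow d (v i) k * tpow d (v j) k = if i = j then 1 else 0 := by
    intro i j
    have : ∑ k, tpow d (v i) k * tpow d (v j) k = form (tpow d (v i)) (v j) := rfl
    rw [this, form_tpow, (orthonormal_iff_ite.1 hv) i j]
    split_ifs <;> simp [hd]
  simp [h2, sq]

theorem hsNorm_tpow {v : Vec n} (hv : ‖v‖ = 1) : hsNorm (tpow d v) = 1 := by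
  have h : ∑ k, tpow d v k * tpow d v k = form (tpow d v) v := rfl
  rw [hsNorm]
  simp only [sq, h, form_tpow, real_inner_self_eq_norm_sq, hv]
  simp

theorem iter_eq_of_toMap {F : Tensor n (p + 1)} {k : ℕ} {T : Tensor n (p ^ k + 1)}
    (hT : IsPartSymm T) (h : ∀ x, (toMap F)^[k] x = toMap T x) : iter F k = T :=
  (isPartSymm_iter F k).ext_toMap hT fun x => by rw [toMap_iter, h]

end Symmetric

/-! ### Banach's theorem on symmetric multilinear forms. -/

section Banach

variable {ι E : Type*} [Fintype ι] [NormedAddCommGroup E] [InnerProductSpace ℝ E]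

theorem abs_le_mul_prod_norm (f : MultilinearMap ℝ (fun _ : ι => E) ℝ) {M : ℝ}
    (h : ∀ x : ι → E, (∀ s, ‖x s‖ = 1) → |f x| ≤ M) (x : ι → E) : |f x| ≤ M * ∏ s, ‖x s‖ := by
  by_cases h0 : ∃ s, x s = 0
  · obtain ⟨s, hs⟩ := h0
    rw [f.map_coord_zero s hs, Finset.prod_eq_zero (Finset.mem_univ s) (by simp [hs])]
    simp
  · push Not at h0
    have hx : x = fun s => ‖x s‖ • (‖x s‖⁻¹ • x s) := by
      funext s
      rw [smul_smul, mul_inv_cancel₀ (norm_ne_zero_iff.2 (h0 s)), one_smul]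
    have h1 := h (fun s => ‖x s‖⁻¹ • x s) fun s => by
      rw [norm_smul, norm_inv, norm_norm, inv_mul_cancel₀ (norm_ne_zero_iff.2 (h0 s))]
    have hP : (0 : ℝ) ≤ ∏ s, ‖x s‖ := Finset.prod_nonneg fun _ _ => norm_nonneg _
    conv_lhs => rw [hx]
    rw [f.map_smul_univ (fun s => ‖x s‖), smul_eq_mul, abs_mul, abs_of_nonneg hP, mul_comm]
    exact mul_le_mul_of_nonneg_right h1 hP

/-- If a symmetric bilinear form attains its norm at a pair of unit vectors, then it attains it
on the diagonal, in the direction of their sum. -/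
theorem abs_bilin_add_self (B : E → E → ℝ) (hadd : ∀ x y z, B (x + y) z = B x z + B y z)
    (hneg : ∀ x z, B (-x) z = -B x z) (hsymm : ∀ x y, B x y = B y x) {M : ℝ}
    (hM : ∀ x y, |B x y| ≤ M * (‖x‖ * ‖y‖)) {x y : E} (hx : ‖x‖ = 1) (hy : ‖y‖ = 1)
    (hxy : |B x y| = M) : |B (x + y) (x + y)| = M * ‖x + y‖ ^ 2 := by
  have hadd' : ∀ x y z, B z (x + y) = B z x + B z y := fun x y z => by
    rw [hsymm, hadd, hsymm x, hsymm y]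
  have hneg' : ∀ x z, B z (-x) = -B z x := fun x z => by rw [hsymm, hneg, hsymm x]
  -- Polarization writes `4 * B x y` through two diagonal values whose bounds add up to exactly `4 *
  -- M` by the parallelogram law, so both bounds are attained.
  have e1 : B (x + y) (x + y) - B (x + -y) (x + -y) = 4 * B x y := by
    simp only [hadd, hadd', hneg, hneg']
    rw [hsymm y x]; ring
  have e2 : ‖x + y‖ ^ 2 + ‖x + -y‖ ^ 2 = 4 := by
    have := parallelogram_law_with_norm ℝ x y
    rw [← sub_eq_add_neg]
    rw [hx, hy] at this
    nlinarith
  have h1 := hM (x + y) (x + y)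
  have h2 := hM (x + -y) (x + -y)
  rw [← sq] at h1 h2
  refine le_antisymm h1 ?_
  have h3 : 4 * M ≤ |B (x + y) (x + y)| + |B (x + -y) (x + -y)| := by
    rw [← hxy]
    calc 4 * |B x y| = |4 * B x y| := by rw [abs_mul]; norm_num
      _ ≤ _ := by rw [← e1]; exact abs_sub _ _
  have h4 : M * ‖x + y‖ ^ 2 + M * ‖x + -y‖ ^ 2 = 4 * M := by rw [← mul_add, e2, mul_comm]
  linarith

variable [FiniteDimensional ℝ E] [Nontrivial E]

/-- **Banach's theorem**: a symmetric multilinear form attains its norm on the diagonal. -/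
theorem exists_diag_max (f : ContinuousMultilinearMap ℝ (fun _ : ι => E) ℝ)
    (hsymm : ∀ (σ : Equiv.Perm ι) (x : ι → E), f (x ∘ σ) = f x) :
    ∃ u : E, ‖u‖ = 1 ∧ ∀ x : ι → E, (∀ s, ‖x s‖ = 1) → |f x| ≤ |f fun _ => u| := by
  classical
  have : ProperSpace E := FiniteDimensional.proper_real E
  obtain ⟨e, he⟩ := exists_norm_eq E (zero_le_one' ℝ)
  let K : Set (ι → E) := Set.univ.pi fun _ => Metric.sphere 0 1
  have hKmem : ∀ x, x ∈ K ↔ ∀ s, ‖x s‖ = 1 := fun x => by simp [K]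
  have hK : IsCompact K := isCompact_univ_pi fun _ => isCompact_sphere 0 1
  obtain ⟨x₀, hx₀, hmax₀⟩ := hK.exists_isMaxOn (f := fun x => |f x|)
    ⟨fun _ => e, (hKmem _).2 fun _ => he⟩ (by fun_prop)
  set M := |f x₀| with hMdef
  have hM : ∀ x : ι → E, |f x| ≤ M * ∏ s, ‖x s‖ :=
    abs_le_mul_prod_norm f.toMultilinearMap fun x hx => hmax₀ ((hKmem x).2 hx)
  -- Among the maximizers of `|f|`, one with the longest sum `∑ s, x s` is chosen; all its entries
  -- turn out to be equal.
  let K' : Set (ι → E) := K ∩ {x | |f x| = M}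
  have hK' : IsCompact K' :=
    hK.inter_right (isClosed_eq (by fun_prop) continuous_const)
  obtain ⟨x, ⟨hxK, hxM⟩, hmax⟩ := hK'.exists_isMaxOn (f := fun x => ‖∑ s, x s‖)
    ⟨x₀, hx₀, rfl⟩ (by fun_prop)
  replace hxM : |f x| = M := hxM
  rw [hKmem] at hxK
  have hmax' : ∀ y : ι → E, (∀ s, ‖y s‖ = 1) → |f y| = M → ‖∑ s, y s‖ ≤ ‖∑ s, x s‖ :=
    fun y hy hyM => hmax ⟨(hKmem y).2 hy, hyM⟩
  set S := ∑ s, x s with hS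
  have hsum : ∀ (y : ι → E) (i : ι) (a : E),
      ∑ s, Function.update y i a s = ∑ s, y s - y i + a := by
    intro y i a
    rw [Finset.sum_update_of_mem (Finset.mem_univ i), ← Finset.add_sum_erase _ _ (Finset.mem_univ i),
      Finset.sdiff_singleton_eq_erase]
    abel
  have hneg : ∀ (y : ι → E) (i : ι) (a : E),
      f (Function.update y i (-a)) = -f (Function.update y i a) :=
    f.toMultilinearMap.map_update_neg
  -- Flipping the sign of `x i` preserves `|f|`, so `‖S - 2 x i‖ ≤ ‖S‖`.
  have hge : ∀ i, 1 ≤ inner ℝ S (x i) := by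
    intro i
    have h1 : |f (Function.update x i (-x i))| = M := by
      rw [← hxM, hneg, Function.update_eq_self, abs_neg]
    have h2 := hmax' _ (fun s => by
      by_cases hs : s = i
      · subst hs; simp [hxK]
      · simp [hs, hxK]) h1
    rw [hsum] at h2
    have h3 : S - x i + -x i = S - (2 : ℝ) • x i := by rw [two_smul]; abel
    rw [← hS, h3] at h2
    have h4 := mul_self_le_mul_self (norm_nonneg _) h2
    rw [← sq, ← sq, norm_sub_sq_real, norm_smul, inner_smul_right, hxK] at h4
    norm_num at h4
    linarith
  -- If `x i ≠ x j`, replacing both by the normalized `w = x i + x j` keeps a maximizer, and the sum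
  -- becomes `S + (2 / ‖w‖ - 1) w`. This is longer than `S`, because `‖w‖ < 2` and `⟨S, w⟩ > 0`.
  have hall : ∀ i j, x i = x j := by
    intro i j
    by_contra hne
    have hij : j ≠ i := fun h => hne (by rw [h])
    set w := x i + x j with hw
    have hSw : 2 ≤ inner ℝ S w := by
      rw [hw, inner_add_right]; linarith [hge i, hge j]
    have hw0 : w ≠ 0 := fun h => by rw [h, inner_zero_right] at hSw; norm_num at hSw
    have hwpos : 0 < ‖w‖ := norm_pos_iff.2 hw0
    have hw2 : ‖w‖ < 2 := by
      have h1 : inner ℝ (x i) (x j) < 1 :=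
        (inner_lt_one_iff_real_of_norm_eq_one (hxK i) (hxK j)).2 hne
      have h2 := norm_add_sq_real (x i) (x j)
      rw [← hw, hxK, hxK] at h2
      nlinarith
    let B : E → E → ℝ := fun a b => f (Function.update (Function.update x i a) j b)
    have hBM : ∀ a b, |B a b| ≤ M * (‖a‖ * ‖b‖) := by
      intro a b
      refine (hM _).trans_eq ?_
      congr 1
      have hb : ∀ s, ‖Function.update (Function.update x i a) j b s‖
          = Function.update (Function.update (fun _ => (1 : ℝ)) i ‖a‖) j ‖b‖ s := by
        intro s
        by_cases h1 : s = j
        · subst h1; simp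
        · by_cases h2 : s = i
          · subst h2; simp [h1]
          · simp [h1, h2, hxK]
      rw [Finset.prod_congr rfl fun s _ => hb s,
        Finset.prod_update_of_mem (Finset.mem_univ j), Finset.prod_update_of_mem (by simp [hij.symm])]
      simp [mul_comm]
    have hBadd : ∀ a b c, B (a + b) c = B a c + B b c := by
      intro a b c
      simp only [B, Function.update_comm hij.symm, f.map_update_add]
    have hBneg : ∀ a c, B (-a) c = -B a c := by
      intro a c
      simp only [B, Function.update_comm hij.symm, hneg]
    have hBsymm : ∀ a b, B a b = B b a := by
      intro a b
      simp only [B]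
      rw [← hsymm (Equiv.swap i j)]
      congr 1
      funext s
      by_cases h1 : s = j
      · subst h1; simp [hij.symm]
      · by_cases h2 : s = i
        · subst h2; simp [h1]
        · simp [Equiv.swap_apply_of_ne_of_ne h2 h1, h1, h2]
    have hBx : |B (x i) (x j)| = M := by simp [B, hxM]
    have hBw := abs_bilin_add_self B hBadd hBneg hBsymm hBM (hxK i) (hxK j) hBx
    rw [← hw] at hBw
    set u := ‖w‖⁻¹ • w with hu
    have hun : ‖u‖ = 1 := by
      rw [hu, norm_smul, norm_inv, norm_norm, inv_mul_cancel₀ hwpos.ne']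
    have hBu : |B u u| = M := by
      have : B u u = ‖w‖⁻¹ * (‖w‖⁻¹ * B w w) := by
        simp only [B, hu]
        rw [f.map_update_smul, Function.update_comm hij.symm, f.map_update_smul,
          Function.update_comm hij]
        rfl
      rw [this, abs_mul, abs_mul, hBw, abs_inv, abs_norm]
      field_simp
    have h1 := hmax' _ (fun s => by
      by_cases h1 : s = j
      · subst h1; simp [hun]
      · by_cases h2 : s = i
        · subst h2; simp [h1, hun]
        · simp [h1, h2, hxK]) hBu
    rw [hsum, hsum, ← hS, Function.update_of_ne hij] at h1
    have h3 : S - x i + u - x j + u = S + (2 * ‖w‖⁻¹ - 1) • w := by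
      rw [sub_smul, mul_smul, ← hu, one_smul, two_smul, hw]; abel
    rw [h3] at h1
    have h4 := mul_self_le_mul_self (norm_nonneg _) h1
    rw [← sq, ← sq, norm_add_sq_real, inner_smul_right] at h4
    have ht : 0 < 2 * ‖w‖⁻¹ - 1 := by
      rw [sub_pos, ← div_eq_mul_inv, lt_div_iff₀ hwpos]; linarith
    nlinarith [sq_nonneg ‖(2 * ‖w‖⁻¹ - 1) • w‖, mul_pos ht (by linarith : (0 : ℝ) < inner ℝ S w)]
  by_cases hι : Nonempty ι
  · obtain ⟨i₀⟩ := hι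
    refine ⟨x i₀, hxK i₀, fun y hy => ?_⟩
    have : (fun _ => x i₀) = x := funext fun j => hall i₀ j
    rw [this, hxM]
    exact hmax₀ ((hKmem y).2 hy)
  · rw [not_nonempty_iff] at hι
    exact ⟨e, he, fun y _ => by rw [Subsingleton.elim y fun _ => e]⟩

end Banach

/-! ### The spectral norm, gradients of forms, and polynomial maps on the sphere. -/

section SpectralNorm

variable {n d p q : ℕ}

theorem bddAbove_specNorm (T : Tensor n d) :
    BddAbove {r | ∃ x : Fin d → Vec n, (∀ s, ‖x s‖ = 1) ∧ r = |pairing T x|} := by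
  refine ⟨hsNorm T, ?_⟩
  rintro r ⟨x, hx, rfl⟩
  simpa [hx] using abs_pairing_le T x

theorem abs_pairing_le_specNorm (T : Tensor n d) {x : Fin d → Vec n} (hx : ∀ s, ‖x s‖ = 1) :
    |pairing T x| ≤ specNorm T :=
  le_csSup (bddAbove_specNorm T) ⟨x, hx, rfl⟩

theorem specNorm_nonneg (T : Tensor n d) : 0 ≤ specNorm T :=
  Real.sSup_nonneg fun _ ⟨_, _, h⟩ => h ▸ abs_nonneg _

theorem specNorm_le_hsNorm (T : Tensor n d) : specNorm T ≤ hsNorm T :=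
  Real.sSup_le (fun r ⟨x, hx, h⟩ => by
    rw [h]; simpa [hx] using abs_pairing_le T x) (hsNorm_nonneg T)

/-- Differentiating on the diagonal puts the direction `y` into each of the `p + 1` slots; by
symmetry every term equals `⟨y, toMap T x⟩`. -/
theorem IsSymm.hasGradientAt_form {T : Tensor n (p + 1)} (hT : IsSymm T) (x : Vec n) :
    HasGradientAt (form T) (((p : ℝ) + 1) • toMap T x) x := by
  have h1 : HasFDerivAt (fun x : Vec n => pairingMap T fun _ => x)
      (((pairingMap T).linearDeriv fun _ => x).comp
        (ContinuousLinearMap.pi fun _ => ContinuousLinearMap.id ℝ (Vec n))) x :=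
    ((pairingMap T).hasFDerivAt fun _ => x).comp x
      (ContinuousLinearMap.pi fun _ => ContinuousLinearMap.id ℝ (Vec n)).hasFDerivAt
  rw [hasGradientAt_iff_hasFDerivAt]
  refine h1.congr_fderiv ?_
  ext y
  have h2 : ∀ s : Fin (p + 1), pairing T (Function.update (fun _ => x) s y)
      = inner ℝ y (toMap T x) := by
    intro s
    rw [inner_toMap, ← hT.pairing_comp (Equiv.swap 0 s)]
    congr 1
    funext t
    by_cases ht : t = 0
    · subst ht; simp
    · obtain ⟨t, rfl⟩ := Fin.exists_succ_eq.2 ht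
      rw [Fin.cons_succ, Function.comp, Function.update_of_ne]
      intro h
      rw [Equiv.swap_apply_eq_iff] at h
      simp at h
  simp [h2, real_inner_comm y]

/-- The tensor is tested on the unit vector along `toMap T x` in the first slot and `x` in the
others. -/
theorem norm_toMap_le (T : Tensor n (p + 1)) {x : Vec n} (hx : ‖x‖ = 1) :
    ‖toMap T x‖ ≤ specNorm T := by
  by_cases h0 : toMap T x = 0
  · rw [h0, norm_zero]; exact specNorm_nonneg T
  · have hne := norm_ne_zero_iff.2 h0
    have h := abs_pairing_le_specNorm T
      (x := Fin.cons (‖toMap T x‖⁻¹ • toMap T x) fun _ => x) fun s => by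
        refine Fin.cases ?_ (fun s => ?_) s
        · simp [norm_smul, hne]
        · simpa using hx
    rw [← inner_toMap, real_inner_smul_left, real_inner_self_eq_norm_sq] at h
    have h2 : ‖toMap T x‖⁻¹ * ‖toMap T x‖ ^ 2 = ‖toMap T x‖ := by field_simp
    rwa [h2, abs_norm] at h

variable [NeZero n]

instance : Nontrivial (Vec n) := by
  refine ⟨EuclideanSpace.single 0 1, 0, fun h => ?_⟩
  have := congrArg (fun v : Vec n => v 0) h
  simp at this

theorem IsSymm.exists_specNorm_eq {T : Tensor n d} (hT : IsSymm T) :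
    ∃ u : Vec n, ‖u‖ = 1 ∧ |form T u| = specNorm T := by
  obtain ⟨u, hu, h⟩ := exists_diag_max (pairingMap T) fun σ x => hT.pairing_comp σ x
  refine ⟨u, hu, le_antisymm (abs_pairing_le_specNorm T fun _ => hu) ?_⟩
  refine Real.sSup_le ?_ (abs_nonneg _)
  rintro r ⟨x, hx, rfl⟩
  exact h x hx

/-- The spectral norm of a tensor symmetric in the last `p` indices is the maximum of the norm
of its polynomial map on the unit sphere. -/
theorem IsPartSymm.exists_specNorm_eq {T : Tensor n (p + 1)} (hT : IsPartSymm T) :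
    ∃ u : Vec n, ‖u‖ = 1 ∧ ‖toMap T u‖ = specNorm T := by
  have hcomp : IsCompact (Metric.sphere (0 : Vec n) 1) := isCompact_sphere 0 1
  have hcont : Continuous (toMap T) := by
    unfold toMap; fun_prop
  obtain ⟨e, he⟩ := exists_norm_eq (Vec n) (zero_le_one' ℝ)
  obtain ⟨u, hu, hmax⟩ := hcomp.exists_isMaxOn (f := fun x => ‖toMap T x‖)
    ⟨e, by simpa using he⟩ (by fun_prop)
  have hu1 : ‖u‖ = 1 := by simpa using hu
  refine ⟨u, hu1, le_antisymm (norm_toMap_le T hu1) ?_⟩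
  refine Real.sSup_le ?_ (norm_nonneg _)
  rintro r ⟨x, hx, rfl⟩
  obtain ⟨y, z, rfl⟩ : ∃ y z, x = Fin.cons y z := ⟨x 0, Fin.tail x, (Fin.cons_self_tail x).symm⟩
  have hy : ‖y‖ = 1 := by simpa using hx 0
  have hz : ∀ s, ‖z s‖ = 1 := fun s => by simpa using hx s.succ
  -- Contracting the first index with `y` leaves a symmetric tensor, so Banach's theorem replaces
  -- the other arguments by a single unit vector `v`.
  let T' : Tensor n p := fun j => ∑ i, y i * T (Fin.cons i j)
  have hT' : IsSymm T' := fun σ j => Finset.sum_congr rfl fun i _ => by rw [hT σ i j]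
  obtain ⟨v, hv, hv'⟩ := hT'.exists_specNorm_eq
  rw [pairing_cons]
  refine (abs_pairing_le_specNorm T' hz).trans ?_
  rw [← hv', form, ← pairing_cons, ← inner_toMap]
  refine (abs_real_inner_le_norm _ _).trans ?_
  rw [hy, one_mul]
  exact hmax (by simpa using hv)

theorem norm_toMap_le_mul (T : Tensor n (p + 1)) (x : Vec n) :
    ‖toMap T x‖ ≤ specNorm T * ‖x‖ ^ p := by
  by_cases hx : x = 0
  · subst hx
    obtain ⟨e, he⟩ := exists_norm_eq (Vec n) (zero_le_one' ℝ)
    have := toMap_smul_vec T 0 e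
    rw [zero_smul] at this
    rw [this, norm_smul, norm_zero, norm_pow, norm_zero, mul_comm]
    exact mul_le_mul_of_nonneg_right (norm_toMap_le T he) (by positivity)
  · have hne := norm_ne_zero_iff.2 hx
    have h := norm_toMap_le T (x := ‖x‖⁻¹ • x) (by simp [norm_smul, hne])
    rw [toMap_smul_vec, norm_smul, norm_pow, norm_inv, norm_norm, inv_pow,
      inv_mul_le_iff₀ (by positivity), mul_comm] at h
    exact h

theorem IsPartSymm.eq_zero_of_specNorm_eq_zero {T : Tensor n (p + 1)} (hT : IsPartSymm T)
    (h : specNorm T = 0) : T = 0 :=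
  hT.ext_toMap IsPartSymm.zero fun x => by
    have := norm_toMap_le_mul T x
    rw [h, zero_mul] at this
    rw [toMap_zero_tensor, norm_le_zero_iff.1 this]

theorem IsSymm.formNorm_eq {T : Tensor n d} (hT : IsSymm T) : formNorm (form T) = specNorm T := by
  obtain ⟨u, hu, hu'⟩ := hT.exists_specNorm_eq
  have hle : ∀ r ∈ {r | ∃ x : Vec n, ‖x‖ = 1 ∧ r = |form T x|}, r ≤ specNorm T := by
    rintro r ⟨x, hx, rfl⟩
    exact abs_pairing_le_specNorm T fun _ => hx
  exact le_antisymm (Real.sSup_le hle (specNorm_nonneg T))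
    (le_csSup ⟨_, hle⟩ ⟨u, hu, hu'.symm⟩)

end SpectralNorm

/-! ### Sequences with `N (k + l) ≤ N k * N l ^ p ^ k`. -/

section Sequences

variable {p : ℕ} {N : ℕ → ℝ}

theorem pow_sub_one_pos (hp : 2 ≤ p) {k : ℕ} (hk : 1 ≤ k) : (0 : ℝ) < (p : ℝ) ^ k - 1 := by
  have : (1 : ℝ) < p := by exact_mod_cast hp
  exact sub_pos.2 (one_lt_pow₀ this (by omega))

theorem normExp_pos (hp : 2 ≤ p) {k : ℕ} (hk : 1 ≤ k) : 0 < normExp p k := by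
  have : (1 : ℝ) < p := by exact_mod_cast hp
  exact div_pos (by linarith) (pow_sub_one_pos hp hk)

theorem geom_exponent_succ (hp : 2 ≤ p) (k : ℕ) :
    (p ^ (k + 1) - 1) / (p - 1) = (p ^ k - 1) / (p - 1) + p ^ k := by
  rw [← Nat.geomSum_eq hp, ← Nat.geomSum_eq hp, Finset.sum_range_succ]

theorem geom_exponent_one (hp : 2 ≤ p) : (p ^ 1 - 1) / (p - 1) = 1 := by
  rw [pow_one]; exact Nat.div_self (by omega)

/-- This makes `k ↦ B ^ ((p ^ k - 1) / (p - 1))` an equality case of the submultiplicative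
inequality. -/
theorem geom_exponent_add (hp : 2 ≤ p) (k l : ℕ) :
    (p ^ (k + l) - 1) / (p - 1) = (p ^ k - 1) / (p - 1) + p ^ k * ((p ^ l - 1) / (p - 1)) := by
  rw [← Nat.geomSum_eq hp, ← Nat.geomSum_eq hp, ← Nat.geomSum_eq hp, Finset.sum_range_add,
    Finset.mul_sum]
  simp [pow_add]

theorem normExp_eq (hp : 2 ≤ p) (k : ℕ) :
    normExp p k = (((p ^ k - 1) / (p - 1) : ℕ) : ℝ)⁻¹ := by
  have h1 : (1 : ℝ) < p := by exact_mod_cast hp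
  rw [← Nat.geomSum_eq hp, normExp]
  push_cast
  rw [geom_sum_eq h1.ne', inv_div]

theorem geom_exponent_ge (hp : 2 ≤ p) (k : ℕ) : k ≤ (p ^ k - 1) / (p - 1) := by
  rw [← Nat.geomSum_eq hp]
  calc k = ∑ _i ∈ Finset.range k, 1 := by simp
    _ ≤ _ := Finset.sum_le_sum fun i _ => Nat.one_le_pow _ _ (by omega)

theorem pow_rpow_normExp (hp : 2 ≤ p) {k : ℕ} (hk : 1 ≤ k) {a : ℝ} (ha : 0 ≤ a) :
    (a ^ ((p ^ k - 1) / (p - 1))) ^ normExp p k = a := by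
  rw [normExp_eq hp]
  exact Real.pow_rpow_inv_natCast ha (by have := geom_exponent_ge hp k; omega)

theorem rpow_normExp_pow (hp : 2 ≤ p) {k : ℕ} (hk : 1 ≤ k) {a : ℝ} (ha : 0 ≤ a) :
    (a ^ normExp p k) ^ ((p ^ k - 1) / (p - 1)) = a := by
  rw [normExp_eq hp]
  exact Real.rpow_inv_natCast_pow ha (by have := geom_exponent_ge hp k; omega)

theorem tendsto_normExp (hp : 2 ≤ p) : Tendsto (normExp p) atTop (𝓝 0) := by
  rw [funext (normExp_eq hp)]
  refine tendsto_inv_atTop_zero.comp (tendsto_natCast_atTop_atTop.comp ?_)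
  exact tendsto_atTop_mono (geom_exponent_ge hp) tendsto_id

theorem tendsto_const_rpow_normExp (hp : 2 ≤ p) {C : ℝ} (hC : 0 < C) :
    Tendsto (fun k => C ^ normExp p k) atTop (𝓝 1) := by
  have := (Real.continuous_const_rpow hC.ne').tendsto 0 |>.comp (tendsto_normExp hp)
  simpa [Function.comp_def] using this

theorem rpow_normExp_add_self_le (hp : 2 ≤ p) (hN : ∀ k, 0 ≤ N k)
    (hsub : ∀ k l, N (k + l) ≤ N k * N l ^ p ^ k) {k : ℕ} (hk : 1 ≤ k) :
    N (k + k) ^ normExp p (k + k) ≤ N k ^ normExp p k := by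
  have hf : 0 ≤ N k ^ normExp p k := Real.rpow_nonneg (hN k) _
  have h1 : N (k + k) ≤ (N k ^ normExp p k) ^ ((p ^ (k + k) - 1) / (p - 1)) := by
    rw [geom_exponent_add hp, pow_add, mul_comm (p ^ k), pow_mul, rpow_normExp_pow hp hk (hN k)]
    exact hsub k k
  calc N (k + k) ^ normExp p (k + k)
      ≤ ((N k ^ normExp p k) ^ ((p ^ (k + k) - 1) / (p - 1))) ^ normExp p (k + k) :=
        Real.rpow_le_rpow (hN _) h1 (normExp_pos hp (by omega)).le
    _ = _ := pow_rpow_normExp hp (by omega) hf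

theorem rpow_normExp_antitone (hp : 2 ≤ p) (hN : ∀ k, 0 ≤ N k)
    (hsub : ∀ k l, N (k + l) ≤ N k * N l ^ p ^ k) {m : ℕ} (hm : 1 ≤ m) :
    Antitone fun l : ℕ => N (m * 2 ^ l) ^ normExp p (m * 2 ^ l) := by
  refine antitone_nat_of_succ_le fun l => ?_
  have hk2 : m * 2 ^ (l + 1) = m * 2 ^ l + m * 2 ^ l := by ring
  rw [hk2]
  exact rpow_normExp_add_self_le hp hN hsub (Nat.one_le_iff_ne_zero.2 (by positivity))

/-- Blocks of length `l` are peeled off by induction on `q`. The inequality compares the ratios `N k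
/ B ^ e k` at `r + q * l` and `r`, with `e k = (p ^ k - 1) / (p - 1)`, and is cleared of
denominators so as to allow `B = 0`. -/
theorem le_mul_pow_of_submul (hsub : ∀ k l, N (k + l) ≤ N k * N l ^ p ^ k) (hp : 2 ≤ p)
    {l : ℕ} {B : ℝ} (hN : ∀ k, 0 ≤ N k) (hB : N l ≤ B ^ ((p ^ l - 1) / (p - 1))) (hB0 : 0 ≤ B)
    (r q : ℕ) :
    N (r + q * l) * B ^ ((p ^ r - 1) / (p - 1)) ≤ N r * B ^ ((p ^ (r + q * l) - 1) / (p - 1)) := by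
  induction q with
  | zero => simp
  | succ q ih =>
    have h := hsub (r + q * l) l
    have e : r + (q + 1) * l = r + q * l + l := by ring
    rw [e, geom_exponent_add hp (r + q * l) l, pow_add, ← mul_assoc, mul_comm (p ^ (r + q * l)),
      pow_mul]
    calc _ ≤ N (r + q * l) * N l ^ p ^ (r + q * l) * B ^ ((p ^ r - 1) / (p - 1)) := by gcongr
      _ = N (r + q * l) * B ^ ((p ^ r - 1) / (p - 1)) * N l ^ p ^ (r + q * l) := by ring
      _ ≤ _ := mul_le_mul ih (pow_le_pow_left₀ (hN _) hB _) (pow_nonneg (hN _) _)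
          (mul_nonneg (hN _) (by positivity))

theorem rpow_normExp_le (hp : 2 ≤ p) (hN : ∀ k, 0 ≤ N k)
    (hsub : ∀ k l, N (k + l) ≤ N k * N l ^ p ^ k) {k : ℕ} (hk : 1 ≤ k) :
    N k ^ normExp p k ≤ N 1 := by
  have e1 := geom_exponent_one hp
  have h := le_mul_pow_of_submul hsub hp hN (l := 1) (B := N 1) (by rw [e1, pow_one]) (hN 1) 1 (k - 1)
  have e2 : 1 + (k - 1) * 1 = k := by omega
  rw [e1, e2, pow_one] at h
  have h1 : N k ≤ N 1 ^ ((p ^ k - 1) / (p - 1)) := by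
    rcases (hN 1).eq_or_lt with h0 | h0
    · have := hsub (k - 1) 1
      rw [Nat.sub_add_cancel hk, ← h0, zero_pow (by positivity), mul_zero] at this
      exact this.trans (pow_nonneg (hN 1) _)
    · exact le_of_mul_le_mul_right (by linarith) h0
  calc _ ≤ (N 1 ^ ((p ^ k - 1) / (p - 1))) ^ normExp p k :=
        Real.rpow_le_rpow (hN _) h1 (normExp_pos hp hk).le
    _ = _ := pow_rpow_normExp hp hk (hN 1)

/-- A Fekete-type lemma. -/
theorem exists_tendsto_rpow_normExp (hp : 2 ≤ p) (hN : ∀ k, 0 ≤ N k)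
    (hsub : ∀ k l, N (k + l) ≤ N k * N l ^ p ^ k) :
    ∃ ρ, Tendsto (fun k => N k ^ normExp p k) atTop (𝓝 ρ) := by
  set f := fun k => N k ^ normExp p k with hf
  have hf0 : ∀ k, 0 ≤ f k := fun k => Real.rpow_nonneg (hN k) _
  have hbdd : BddBelow (f '' Set.Ici 1) := ⟨0, by rintro _ ⟨k, _, rfl⟩; exact hf0 k⟩
  -- The index `0` is left out: `normExp p 0 = 0` by division by zero, so `f 0 = 1` carries no
  -- information.
  set ρ := sInf (f '' Set.Ici 1) with hρ
  refine ⟨ρ, tendsto_order.2 ⟨fun b hb => ?_, fun b hb => ?_⟩⟩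
  · filter_upwards [eventually_ge_atTop 1] with k hk
    exact hb.trans_le (csInf_le hbdd ⟨k, hk, rfl⟩)
  obtain ⟨B, hρB, hBb⟩ := exists_between hb
  obtain ⟨_, ⟨l, hl, rfl⟩, hlB⟩ := exists_lt_of_csInf_lt (Set.nonempty_Ici.image f) hρB
  replace hl : 1 ≤ l := hl
  have hB : 0 < B := (hf0 l).trans_lt hlB
  have hlB' : N l ≤ B ^ ((p ^ l - 1) / (p - 1)) := by
    rw [← rpow_normExp_pow hp hl (hN l)]
    exact pow_le_pow_left₀ (hf0 l) hlB.le _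
  -- The sum dominates the contribution of every remainder `k % l`; the summand `1` keeps `C`
  -- positive, so that `C ^ normExp p k` tends to `1`.
  set C := 1 + ∑ r ∈ Finset.range l, N r / B ^ ((p ^ r - 1) / (p - 1)) with hC
  have hterm : ∀ r, 0 ≤ N r / B ^ ((p ^ r - 1) / (p - 1)) := fun r => div_nonneg (hN r) (by positivity)
  have hC0 : 0 < C := add_pos_of_pos_of_nonneg one_pos (Finset.sum_nonneg fun r _ => hterm r)
  have hkey : ∀ k, N k ≤ C * B ^ ((p ^ k - 1) / (p - 1)) := by
    intro k
    have h := le_mul_pow_of_submul hsub hp hN hlB' hB.le (k % l) (k / l)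
    rw [mul_comm (k / l), Nat.mod_add_div] at h
    rw [← le_div_iff₀ (by positivity), mul_comm, mul_div_assoc, mul_comm] at h
    refine h.trans (mul_le_mul_of_nonneg_right ?_ (by positivity))
    have := Finset.single_le_sum (f := fun r => N r / B ^ ((p ^ r - 1) / (p - 1)))
      (fun r _ => hterm r) (Finset.mem_range.2 (Nat.mod_lt k hl))
    linarith
  have hlim : Tendsto (fun k => C ^ normExp p k * B) atTop (𝓝 B) := by
    simpa using (tendsto_const_rpow_normExp hp hC0).mul_const B
  filter_upwards [hlim.eventually_lt_const hBb, eventually_ge_atTop 1] with k hk hk1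
  refine lt_of_le_of_lt ?_ hk
  calc f k ≤ (C * B ^ ((p ^ k - 1) / (p - 1))) ^ normExp p k :=
        Real.rpow_le_rpow (hN _) (hkey k) (normExp_pos hp hk1).le
    _ = _ := by rw [Real.mul_rpow hC0.le (by positivity), pow_rpow_normExp hp hk1 hB.le]

end Sequences

/-! ### Hilbert-Schmidt norm of a composition and its equality case. -/

section Composition

variable {n p q : ℕ}

theorem IsPartSymm.sum_mul_psym {S : Tensor n (p + 1)} (hS : IsPartSymm S)
    (T : Tensor n (p + 1)) : ∑ i, S i * psym T i = ∑ i, S i * T i := by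
  simp only [sum_cons, psym, Fin.cons_zero, Fin.tail_cons]
  refine Finset.sum_congr rfl fun a _ => ?_
  have h : ∀ σ : Equiv.Perm (Fin p),
      ∑ j : Fin p → Fin n, S (Fin.cons a j) * T (Fin.cons a (j ∘ σ))
        = ∑ j : Fin p → Fin n, S (Fin.cons a j) * T (Fin.cons a j) := by
    intro σ
    refine Fintype.sum_equiv (σ.symm.arrowCongr (Equiv.refl _)) _ _ fun j => ?_
    have h1 : (σ.symm.arrowCongr (Equiv.refl (Fin n))) j = j ∘ σ := by
      funext s; simp [Equiv.arrowCongr]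
    rw [h1, hS]
  have h2 : ∀ j : Fin p → Fin n, S (Fin.cons a j) * ((p ! : ℝ)⁻¹ *
      ∑ σ : Equiv.Perm (Fin p), T (Fin.cons a (j ∘ σ)))
      = (p ! : ℝ)⁻¹ * ∑ σ : Equiv.Perm (Fin p), S (Fin.cons a j) * T (Fin.cons a (j ∘ σ)) := by
    intro j
    rw [← Finset.mul_sum]; ring
  simp only [h2]
  rw [← Finset.mul_sum, Finset.sum_comm, Finset.sum_congr rfl fun σ _ => h σ, Finset.sum_const,
    Finset.card_univ, Fintype.card_perm, Fintype.card_fin, nsmul_eq_mul, ← mul_assoc,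
    inv_mul_cancel₀ (by exact_mod_cast Nat.factorial_ne_zero p), one_mul]

/-- `psym` is an orthogonal projection, so `‖T‖² = ‖psym T‖² + ‖T - psym T‖²`. -/
theorem hsNorm_psym_le (T : Tensor n (p + 1)) : hsNorm (psym T) ≤ hsNorm T := by
  refine (sq_le_sq₀ (hsNorm_nonneg _) (hsNorm_nonneg _)).1 ?_
  rw [hsNorm_sq, hsNorm_sq]
  have h := (isPartSymm_psym T).sum_mul_psym T
  have h2 : ∑ i, (T i - psym T i) ^ 2
      = ∑ i, T i ^ 2 - 2 * (∑ i, psym T i * T i) + ∑ i, psym T i ^ 2 := by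
    rw [Finset.mul_sum, ← Finset.sum_sub_distrib, ← Finset.sum_add_distrib]
    exact Finset.sum_congr rfl fun i _ => by ring
  have h3 : ∑ i, psym T i * psym T i = ∑ i, psym T i ^ 2 :=
    Finset.sum_congr rfl fun i _ => by ring
  have h4 : 0 ≤ ∑ i, (T i - psym T i) ^ 2 := Finset.sum_nonneg fun i _ => sq_nonneg _
  linarith

theorem sum_curry {M : Type*} [AddCommMonoid M] (g : (Fin q → Fin p → Fin n) → M) :
    ∑ j : Fin (q * p) → Fin n, g (fun s t => j (finProdFinEquiv (s, t))) = ∑ J, g J :=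
  Fintype.sum_equiv ((finProdFinEquiv.symm.arrowCongr (Equiv.refl (Fin n))).trans
    (Equiv.curry (Fin q) (Fin p) (Fin n))) _ _ fun _ => rfl

/-- The contraction of `G` with copies of `F` whose symmetrization is `comp G F`. -/
def contract (G : Tensor n (q + 1)) (F : Tensor n (p + 1)) : Tensor n (q * p + 1) :=
  fun i => ∑ k : Fin q → Fin n, G (Fin.cons (i 0) k) *
    ∏ s : Fin q, F (Fin.cons (k s) fun t : Fin p => Fin.tail i (finProdFinEquiv (s, t)))

theorem hsNorm_contract_sq (G : Tensor n (q + 1)) (F : Tensor n (p + 1)) :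
    hsNorm (contract G F) ^ 2 = ∑ i, ∑ J : Fin q → Fin p → Fin n,
      (∑ k : Fin q → Fin n, G (Fin.cons i k) * ∏ s, F (Fin.cons (k s) (J s))) ^ 2 := by
  rw [hsNorm_sq, sum_cons]
  refine Finset.sum_congr rfl fun i _ => ?_
  rw [← sum_curry]
  simp [contract]

/-- Arranged as the same double sum as in `hsNorm_contract_sq`, so that Cauchy-Schwarz, and its
equality case, apply term by term. -/
theorem hsNorm_sq_mul_pow (G : Tensor n (q + 1)) (F : Tensor n (p + 1)) :
    (hsNorm G * hsNorm F ^ q) ^ 2 = ∑ i, ∑ J : Fin q → Fin p → Fin n,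
      (∑ k : Fin q → Fin n, G (Fin.cons i k) ^ 2) *
        ∑ k : Fin q → Fin n, (∏ s, F (Fin.cons (k s) (J s))) ^ 2 := by
  have h1 : (∑ J : Fin q → Fin p → Fin n,
      ∑ k : Fin q → Fin n, (∏ s, F (Fin.cons (k s) (J s))) ^ 2) = (hsNorm F ^ 2) ^ q := by
    rw [hsNorm_sq, sum_cons]
    have h2 : ∀ J : Fin q → Fin p → Fin n,
        ∑ k : Fin q → Fin n, (∏ s, F (Fin.cons (k s) (J s))) ^ 2
          = ∏ s, ∑ a, F (Fin.cons a (J s)) ^ 2 := by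
      intro J
      simp only [Finset.prod_univ_sum, Fintype.piFinset_univ, Finset.prod_pow]
    simp only [h2]
    have h3 := Finset.prod_univ_sum (fun _ : Fin q => (Finset.univ : Finset (Fin p → Fin n)))
      fun _ j => ∑ a, F (Fin.cons a j) ^ 2
    rw [Fintype.piFinset_univ] at h3
    rw [← h3, Finset.sum_comm]
    simp
  simp only [← Finset.mul_sum, h1, ← Finset.sum_mul]
  rw [mul_pow, hsNorm_sq, sum_cons, ← pow_mul, ← pow_mul, mul_comm 2]

theorem hsNorm_contract_le (G : Tensor n (q + 1)) (F : Tensor n (p + 1)) :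
    hsNorm (contract G F) ≤ hsNorm G * hsNorm F ^ q := by
  refine (sq_le_sq₀ (hsNorm_nonneg _)
    (mul_nonneg (hsNorm_nonneg _) (pow_nonneg (hsNorm_nonneg _) _))).1 ?_
  rw [hsNorm_contract_sq, hsNorm_sq_mul_pow]
  exact Finset.sum_le_sum fun i _ => Finset.sum_le_sum fun J _ =>
    Finset.sum_mul_sq_le_sq_mul_sq _ _ _

theorem hsNorm_comp_le (G : Tensor n (q + 1)) (F : Tensor n (p + 1)) :
    hsNorm (comp G F) ≤ hsNorm G * hsNorm F ^ q :=
  (hsNorm_psym_le (contract G F)).trans (hsNorm_contract_le G F)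

/-- The equality case of the Cauchy-Schwarz inequality. -/
theorem mul_eq_mul_of_sum_mul_sq_eq {α : Type*} [Fintype α] {f g : α → ℝ}
    (h : (∑ a, f a * g a) ^ 2 = (∑ a, f a ^ 2) * ∑ a, g a ^ 2) (a b : α) :
    f a * g b = f b * g a := by
  have h1 : ∑ a, ∑ b, (f a * g b - f b * g a) ^ 2 = 0 := by
    have : ∀ a b, (f a * g b - f b * g a) ^ 2
        = f a ^ 2 * g b ^ 2 - 2 * ((f a * g a) * (f b * g b)) + g a ^ 2 * f b ^ 2 := by
      intros; ring
    simp only [this, Finset.sum_add_distrib, Finset.sum_sub_distrib, ← Finset.mul_sum,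
      ← Finset.sum_mul]
    rw [mul_comm (∑ a, g a ^ 2), ← h]; ring
  rw [Finset.sum_eq_zero_iff_of_nonneg fun _ _ => Finset.sum_nonneg fun _ _ => sq_nonneg _] at h1
  have h2 := h1 a (Finset.mem_univ _)
  rw [Finset.sum_eq_zero_iff_of_nonneg fun _ _ => sq_nonneg _] at h2
  exact sub_eq_zero.1 (pow_eq_zero_iff two_ne_zero |>.1 (h2 b (Finset.mem_univ _)))

/-- If the Hilbert-Schmidt norm is multiplicative on a composition, both factors split off the
same vector. -/
theorem exists_factor_of_hsNorm_comp_eq {G : Tensor n (q + 1)} {F : Tensor n (p + 1)}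
    (hq : q ≠ 0) (hF : F ≠ 0) (hG : G ≠ 0)
    (h : hsNorm (comp G F) = hsNorm G * hsNorm F ^ q) :
    ∃ (u : Fin n → ℝ) (g : Fin n → ℝ) (w : Tensor n p), (∀ i k, G (Fin.cons i k) = g i * ∏ s, u (k s)) ∧
      (∃ a, w = slice F a) ∧ ∀ i j, F (Fin.cons i j) = u i * w j := by
  have h1 : hsNorm (contract G F) = hsNorm G * hsNorm F ^ q :=
    le_antisymm (hsNorm_contract_le G F) (h ▸ hsNorm_psym_le (contract G F))
  have h2 : hsNorm (contract G F) ^ 2 = (hsNorm G * hsNorm F ^ q) ^ 2 := by rw [h1]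
  rw [hsNorm_contract_sq, hsNorm_sq_mul_pow] at h2
  have hle : ∀ (i : Fin n) (J : Fin q → Fin p → Fin n), _ ≤ _ := fun i J =>
    Finset.sum_mul_sq_le_sq_mul_sq Finset.univ (fun k : Fin q → Fin n => G (Fin.cons i k))
      (fun k => ∏ s, F (Fin.cons (k s) (J s)))
  rw [Finset.sum_eq_sum_iff_of_le fun i _ => Finset.sum_le_sum fun J _ => hle i J] at h2
  have hprop : ∀ (i : Fin n) (J : Fin q → Fin p → Fin n) (k k' : Fin q → Fin n),
      G (Fin.cons i k) * ∏ s, F (Fin.cons (k' s) (J s))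
        = G (Fin.cons i k') * ∏ s, F (Fin.cons (k s) (J s)) := by
    intro i J
    have h3 := h2 i (Finset.mem_univ _)
    rw [Finset.sum_eq_sum_iff_of_le fun J _ => hle i J] at h3
    exact mul_eq_mul_of_sum_mul_sq_eq (h3 J (Finset.mem_univ _))
  obtain ⟨c, hc⟩ := Function.ne_iff.1 hF
  obtain ⟨a₀, j₀, rfl⟩ : ∃ a j, c = Fin.cons a j := ⟨c 0, Fin.tail c, (Fin.cons_self_tail c).symm⟩
  set H := F (Fin.cons a₀ j₀) with hH
  replace hc : H ≠ 0 := hc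
  -- Taking all blocks of `J` equal to `j₀` shows each slice of `G` proportional to a product of
  -- values of `F (·, j₀)`; dividing by `H` normalizes this vector to `1` at `a₀`.
  have hGk : ∀ i k, G (Fin.cons i k)
      = G (Fin.cons i fun _ => a₀) * ∏ s, (F (Fin.cons (k s) j₀) / H) := by
    intro i k
    have h3 := hprop i (fun _ => j₀) k fun _ => a₀
    rw [Finset.prod_const, Finset.card_univ, Fintype.card_fin, ← hH] at h3
    rw [Finset.prod_div_distrib, Finset.prod_const, Finset.card_univ, Fintype.card_fin,
      ← mul_div_assoc, ← h3, mul_div_cancel_right₀ _ (pow_ne_zero _ hc)]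
  refine ⟨fun a => F (Fin.cons a j₀) / H, fun i => G (Fin.cons i fun _ => a₀), slice F a₀, hGk,
    ⟨a₀, rfl⟩, fun a j => ?_⟩
  obtain ⟨q, rfl⟩ := Nat.exists_eq_succ_of_ne_zero hq
  obtain ⟨i, hi⟩ : ∃ i, G (Fin.cons i fun _ => a₀) ≠ 0 := by
    by_contra! hcon
    refine hG (funext fun b => ?_)
    rw [← Fin.cons_self_tail b, hGk, hcon, zero_mul]; rfl
  -- Changing only one block to `j` and one index to `a` yields `F(a, j) F(a₀, j₀) = F(a, j₀) F(a₀,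
  -- j)`, so `F` has rank one as a matrix.
  have h3 := hprop i (Fin.cons j fun _ => j₀) (Fin.cons a fun _ => a₀) fun _ => a₀
  rw [hGk i (Fin.cons a fun _ => a₀)] at h3
  simp only [Nat.succ_eq_add_one, Fin.prod_univ_succ, Fin.cons_zero, Fin.cons_succ,
    Finset.prod_const, Finset.card_univ, Fintype.card_fin, ← hH, div_self hc, one_pow,
    mul_one] at h3
  have h4 : H ^ q ≠ 0 := pow_ne_zero _ hc
  rw [mul_assoc] at h3
  have h5 := mul_left_cancel₀ hi h3
  rw [← mul_assoc] at h5
  exact (mul_right_cancel₀ h4 h5).symm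

theorem isPartSymm_smul_tpow (b : ℝ) (v : Vec n) : IsPartSymm (b • tpow (p + 1) v) :=
  ((tpow_isSymm v).smul b).isPartSymm

theorem toMap_smul_tpow (b : ℝ) (v x : Vec n) :
    toMap (b • tpow (p + 1) v) x = (b * inner ℝ v x ^ p) • v := by
  rw [toMap_smul_tensor, toMap_tpow, smul_smul]

/-- Two commuting maps between which the Hilbert-Schmidt norm is multiplicative are powers of the
same linear form. -/
theorem exists_tpow_of_hsNorm_comp_eq {G : Tensor n (q + 1)} {F : Tensor n (p + 1)}
    (hGs : IsPartSymm G) (hFs : IsPartSymm F)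
    (hq : q ≠ 0) (hF : F ≠ 0) (hG : G ≠ 0)
    (hcomm : ∀ x, toMap G (toMap F x) = toMap F (toMap G x))
    (h : hsNorm (comp G F) = hsNorm G * hsNorm F ^ q) :
    ∃ (v : Vec n) (b c : ℝ), ‖v‖ = 1 ∧ G = b • tpow (q + 1) v ∧ F = c • tpow (p + 1) v ∧
      b ≠ 0 ∧ c ≠ 0 ∧ b * c ^ q = c * b ^ p := by
  obtain ⟨u₀, g₀, w₀, hGu, ⟨a₀, hw₀⟩, hFu⟩ := exists_factor_of_hsNorm_comp_eq hq hF hG h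
  have hGmap₀ : ∀ x, toMap G x = inner ℝ (WithLp.toLp 2 u₀ : Vec n) x ^ q • (WithLp.toLp 2 g₀ : Vec n) := by
    intro x
    ext i
    have := form_tpow (d := q) (WithLp.toLp 2 u₀ : Vec n) x
    rw [← this]
    simp only [toMap, hGu, form, pairing, tpow, PiLp.smul_apply, smul_eq_mul, Finset.sum_mul]
    exact Finset.sum_congr rfl fun j _ => by ring
  have hFmap₀ : ∀ x, toMap F x = form w₀ x • (WithLp.toLp 2 u₀ : Vec n) := by
    intro x
    ext i
    simp only [toMap, hFu, form, pairing, PiLp.smul_apply, smul_eq_mul, Finset.sum_mul]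
    exact Finset.sum_congr rfl fun j _ => by ring
  set u : Vec n := WithLp.toLp 2 u₀ with hu
  have hu0 : u ≠ 0 := by
    intro h0
    refine hF (hFs.ext_toMap IsPartSymm.zero fun x => ?_)
    rw [hFmap₀, h0, smul_zero, toMap_zero_tensor]
  have hun : ‖u‖ ≠ 0 := norm_ne_zero_iff.2 hu0
  set v : Vec n := ‖u‖⁻¹ • u with hv
  have hv1 : ‖v‖ = 1 := by rw [hv, norm_smul, norm_inv, norm_norm, inv_mul_cancel₀ hun]
  have huv : u = ‖u‖ • v := by rw [hv, smul_smul, mul_inv_cancel₀ hun, one_smul]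
  have hvv : inner ℝ v v = (1 : ℝ) := by rw [real_inner_self_eq_norm_sq, hv1]; norm_num
  set g : Vec n := ‖u‖ ^ q • WithLp.toLp 2 g₀ with hg
  have hGmap : ∀ x, toMap G x = inner ℝ v x ^ q • g := by
    intro x
    rw [hGmap₀, huv, real_inner_smul_left, mul_pow, hg, smul_smul, mul_comm]
  set w : Tensor n p := ‖u‖ • w₀ with hw
  have hws : IsSymm w := by rw [hw, hw₀]; exact (hFs.isSymm_slice a₀).smul _
  have hFmap : ∀ x, toMap F x = form w x • v := by
    intro x
    rw [hFmap₀, hw, form, form, pairing_smul, mul_comm, mul_smul, ← huv]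
  clear_value w g v u
  -- Commutation equates a multiple of `g` with a multiple of `v`; at a point where `form w` is
  -- nonzero this makes `g` parallel to `v`.
  have hcomm' : ∀ x, form w x ^ q • g = (inner ℝ v x ^ q) ^ p • form w g • v := by
    intro x
    have := hcomm x
    rw [hFmap, hGmap, hFmap, hGmap, real_inner_smul_right, hvv, mul_one, form_smul_vec,
      mul_smul] at this
    exact this
  have hg0 : g ≠ 0 := by
    intro h0
    refine hG (hGs.ext_toMap IsPartSymm.zero fun x => ?_)
    rw [hGmap, h0, smul_zero, toMap_zero_tensor]
  obtain ⟨x₀, hx₀⟩ : ∃ x, form w x ≠ 0 := by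
    by_contra! hcon
    refine hF (hFs.ext_toMap IsPartSymm.zero fun x => ?_)
    rw [hFmap, hcon, zero_smul, toMap_zero_tensor]
  obtain ⟨b, hb⟩ : ∃ b : ℝ, g = b • v := by
    refine ⟨(form w x₀ ^ q)⁻¹ * ((inner ℝ v x₀ ^ q) ^ p * form w g), ?_⟩
    rw [mul_smul, mul_smul, ← hcomm', smul_smul, inv_mul_cancel₀ (pow_ne_zero _ hx₀), one_smul]
  have hb0 : b ≠ 0 := fun h0 => hg0 (by rw [hb, h0, zero_smul])
  have hv0 : v ≠ 0 := norm_ne_zero_iff.1 (by rw [hv1]; exact one_ne_zero)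
  set c := form w v with hc
  have hrel : ∀ x, form w x ^ q * b = (inner ℝ v x ^ q) ^ p * (b ^ p * c) := by
    intro x
    have := hcomm' x
    rw [hb, form_smul_vec, smul_smul, smul_smul] at this
    exact smul_left_injective ℝ hv0 this
  have hcb : c ^ q * b = b ^ p * c := by
    have := hrel v
    rwa [hvv, one_pow, one_pow, one_mul] at this
  have hpow : ∀ x, form w x ^ q = (inner ℝ v x ^ p * c) ^ q := by
    intro x
    have h1 := hrel x
    rw [← hcb, ← mul_assoc] at h1
    rw [mul_right_cancel₀ hb0 h1]
    ring
  -- Equal `q`-th powers determine reals only up to sign, hence the passage to squares.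
  have hsq : ∀ x, form w x ^ 2 = (inner ℝ v x ^ p * c) ^ 2 := by
    intro x
    have h1 := congrArg abs (hpow x)
    rw [abs_pow, abs_pow] at h1
    rw [← sq_abs, (pow_left_inj₀ (abs_nonneg _) (abs_nonneg _) hq).1 h1, sq_abs]
  have hc0 : c ≠ 0 := by
    intro h0
    have := hsq x₀
    rw [h0, mul_zero, zero_pow two_ne_zero] at this
    exact hx₀ (pow_eq_zero_iff two_ne_zero |>.1 this)
  have hform : ∀ x, form (c • tpow p v) x = inner ℝ v x ^ p * c := by
    intro x
    rw [form, pairing_smul, ← form, form_tpow, mul_comm]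
  -- The polynomial ring is a domain, so the pointwise sign ambiguity is one global sign; the value
  -- `c ≠ 0` at `v` excludes the minus.
  have hpoly : (formPoly w - formPoly (c • tpow p v)) * (formPoly w + formPoly (c • tpow p v))
      = 0 := by
    refine MvPolynomial.funext fun x => ?_
    have h1 := eval_formPoly w (WithLp.toLp 2 x)
    have h2 := eval_formPoly (c • tpow p v) (WithLp.toLp 2 x)
    rw [hform] at h2
    rw [map_mul, map_sub, map_add, map_zero]
    have h3 := hsq (WithLp.toLp 2 x)
    rw [← h1, ← h2] at h3
    simp only at h3
    linear_combination h3
  have hwform : ∀ x, form w x = inner ℝ v x ^ p * c := by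
    rcases mul_eq_zero.1 hpoly with h0 | h0
    · intro x
      rw [← eval_formPoly, sub_eq_zero.1 h0, eval_formPoly, hform]
    · exfalso
      have h1 := eval_formPoly w v
      rw [eq_neg_of_add_eq_zero_left h0, map_neg, eval_formPoly, hform, hvv, one_pow, one_mul,
        ← hc] at h1
      exact hc0 (by linarith)
  refine ⟨v, b, c, hv1, hGs.ext_toMap (isPartSymm_smul_tpow b v) fun x => ?_,
    hFs.ext_toMap (isPartSymm_smul_tpow c v) fun x => ?_, hb0, hc0, by linarith⟩
  · rw [hGmap, toMap_smul_tpow, hb, smul_smul, mul_comm]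
  · rw [hFmap, toMap_smul_tpow, hwform, mul_comm]

/-- Degrees such as `p ^ (k + l)` and `p ^ k * p ^ l` are not definitionally equal, so norms are
compared rather than the tensors themselves. -/
theorem hsNorm_eq_of_toMap_eq (h : p = q) {S : Tensor n (p + 1)} {T : Tensor n (q + 1)}
    (hS : IsPartSymm S) (hT : IsPartSymm T) (hST : ∀ x, toMap S x = toMap T x) :
    hsNorm S = hsNorm T := by
  subst h; rw [hS.ext_toMap hT hST]

theorem specNorm_eq_of_toMap_eq (h : p = q) {S : Tensor n (p + 1)} {T : Tensor n (q + 1)}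
    (hS : IsPartSymm S) (hT : IsPartSymm T) (hST : ∀ x, toMap S x = toMap T x) :
    specNorm S = specNorm T := by
  subst h; rw [hS.ext_toMap hT hST]

end Composition

/-! ### Rank-one iterates as polynomials. -/

section RankOnePolynomial

variable {n d p : ℕ}

theorem sum_expo (i : Fin d → Fin n) : ∑ t, expo i t = d := by
  simp only [expo, Finsupp.coe_finsetSum, Finset.sum_apply]
  rw [Finset.sum_comm]
  simp [Finsupp.single_apply]

/-- The linear form of a vector, as a polynomial. -/
def linPoly (v : Vec n) : MvPolynomial (Fin n) ℝ := ∑ t, MvPolynomial.C (v t) * MvPolynomial.X t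

theorem formPoly_tpow (v : Vec n) : formPoly (tpow d v) = linPoly v ^ d := by
  have h := Finset.prod_univ_sum (fun _ : Fin d => (Finset.univ : Finset (Fin n)))
    fun _ t => (MvPolynomial.C (v t) * MvPolynomial.X t : MvPolynomial (Fin n) ℝ)
  rw [Fintype.piFinset_univ, Finset.prod_const, Finset.card_univ, Fintype.card_fin] at h
  rw [linPoly, h]
  simp [formPoly, tpow, Finset.prod_mul_distrib]

theorem coeff_linPoly_pow (v : Vec n) (i : Fin d → Fin n) :
    MvPolynomial.coeff (expo i) (linPoly v ^ d)
      = (Nat.multinomial Finset.univ (expo i) : ℝ) * ∏ s, v (i s) := by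
  have hprod : ∏ s, v (i s) = ∏ t, v t ^ expo i t := by
    have h := congrArg (MvPolynomial.eval fun t => v t) (prod_X_eq_monomial_expo i)
    rw [MvPolynomial.eval_monomial, Finsupp.prod_fintype _ _ (by simp)] at h
    simpa using h
  rw [linPoly, Finset.sum_pow_eq_sum_piAntidiag, MvPolynomial.coeff_sum]
  have hterm : ∀ k : Fin n → ℕ, MvPolynomial.coeff (expo i)
      ((Nat.multinomial Finset.univ k : MvPolynomial (Fin n) ℝ) *
        ∏ t, (MvPolynomial.C (v t) * MvPolynomial.X t) ^ k t)
      = if k = expo i then (Nat.multinomial Finset.univ k : ℝ) * ∏ t, v t ^ k t else 0 := by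
    intro k
    have h1 : (Nat.multinomial Finset.univ k : MvPolynomial (Fin n) ℝ) *
        ∏ t, (MvPolynomial.C (v t) * MvPolynomial.X t) ^ k t
        = MvPolynomial.monomial (Finsupp.equivFunOnFinite.symm k)
          ((Nat.multinomial Finset.univ k : ℝ) * ∏ t, v t ^ k t) := by
      rw [MvPolynomial.monomial_eq, Finsupp.prod_fintype _ _ (by simp)]
      simp [mul_pow, Finset.prod_mul_distrib, mul_assoc]
    rw [h1, MvPolynomial.coeff_monomial]
    congr 1
    rw [Equiv.symm_apply_eq]
    rfl
  simp only [hterm]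
  rw [Finset.sum_ite_eq_of_mem', hprod]
  simp [sum_expo]

/-- The multinomial coefficients of the expanded power cancel the normalization in `polyTensor`. -/
theorem polyTensor_C_mul_linPoly_pow (b : ℝ) (v : Vec n) :
    polyTensor d (MvPolynomial.C b * linPoly v ^ d) = b • tpow d v := by
  funext i
  have h : (∏ t, ((expo i t)! : ℝ)) * (Nat.multinomial Finset.univ (expo i) : ℝ) = (d ! : ℝ) := by
    have := Nat.multinomial_spec Finset.univ (expo i)
    rw [sum_expo] at this
    exact_mod_cast this
  have hd : (d ! : ℝ) ≠ 0 := by exact_mod_cast Nat.factorial_ne_zero d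
  simp only [polyTensor, MvPolynomial.coeff_C_mul, coeff_linPoly_pow, Pi.smul_apply, smul_eq_mul,
    tpow]
  rw [div_eq_iff hd, ← h]
  ring

theorem sum_sq_eq_one {v : Vec n} (hv : ‖v‖ = 1) : ∑ t, v t * v t = 1 := by
  rw [← inner_eq_sum, real_inner_self_eq_norm_sq, hv, one_pow]

theorem polyMap_smul_tpow (a : ℝ) (v : Vec n) (i : Fin n) :
    polyMap (a • tpow (p + 1) v) i = MvPolynomial.C (a * v i) * linPoly v ^ p := by
  rw [← formPoly_tpow, formPoly, Finset.mul_sum]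
  refine Finset.sum_congr rfl fun j _ => ?_
  rw [← mul_assoc, ← map_mul]
  congr 2
  simp [tpow, Fin.prod_univ_succ, mul_assoc]

theorem polyIter_smul_tpow (hp : 2 ≤ p) (a : ℝ) {v : Vec n} (hv : ‖v‖ = 1) {k : ℕ} (hk : 1 ≤ k)
    (i : Fin n) : polyIter (polyMap (a • tpow (p + 1) v)) k i
      = MvPolynomial.C (a ^ ((p ^ k - 1) / (p - 1)) * v i) * linPoly v ^ p ^ k := by
  induction k, hk using Nat.le_induction with
  | base =>
    rw [geom_exponent_one hp]
    simp [polyIter, polyMap_smul_tpow]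
  | succ k hk ih =>
    simp only [polyIter, ih]
    rw [geom_exponent_succ hp]
    -- Substituting the map into `⟨v, x⟩` gives `a ⟨v, x⟩ ^ p`, because `‖v‖ = 1`.
    have h : MvPolynomial.bind₁ (polyMap (a • tpow (p + 1) v)) (linPoly v)
        = MvPolynomial.C a * linPoly v ^ p := by
      conv_lhs => rw [linPoly]
      simp only [map_sum, map_mul, MvPolynomial.bind₁_C_right, MvPolynomial.bind₁_X_right,
        polyMap_smul_tpow, ← mul_assoc, ← Finset.sum_mul]
      congr 1
      simp only [← map_mul, ← map_sum]
      congr 1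
      calc _ = a * ∑ t, v t * v t := by
            rw [Finset.mul_sum]
            exact Finset.sum_congr rfl fun t _ => by ring
        _ = a := by rw [sum_sq_eq_one hv, mul_one]
    rw [map_mul, map_pow, h, MvPolynomial.bind₁_C_right, mul_pow, ← pow_mul, ← pow_succ',
      ← map_pow, ← mul_assoc, ← map_mul, pow_add]
    congr 2
    ring

theorem polyMapHS_polyIter_smul_tpow (hp : 2 ≤ p) (a : ℝ) {v : Vec n} (hv : ‖v‖ = 1) {k : ℕ}
    (hk : 1 ≤ k) : polyMapHS (p ^ k) (polyIter (polyMap (a • tpow (p + 1) v)) k)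
      = |a| ^ ((p ^ k - 1) / (p - 1)) := by
  simp only [polyMapHS, polyIter_smul_tpow hp a hv hk, polyTensor_C_mul_linPoly_pow, hsNorm_smul,
    hsNorm_tpow hv, mul_one, sq_abs, mul_pow _ (v _), ← Finset.mul_sum]
  have := sum_sq_eq_one hv
  simp only [← sq] at this
  rw [this, mul_one, Real.sqrt_sq_eq_abs, abs_pow]

end RankOnePolynomial

/-! ### Norms of iterates, equality cases, and symmetric tensors. -/

section Iterates

variable {n p : ℕ}

/-- In orthonormal coordinates the map decouples into `t ↦ c i * t ^ p`. For `k = 0` the right side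
would only be the projection onto the span of the `v i`. -/
theorem iterate_sum_smul_tpow {ι : Type*} [Fintype ι] (hp : 2 ≤ p) (c : ι → ℝ) {v : ι → Vec n}
    (hv : Orthonormal ℝ v) {k : ℕ} (hk : 1 ≤ k) (x : Vec n) :
    (toMap (∑ i, c i • tpow (p + 1) (v i)))^[k] x
      = ∑ i, (c i ^ ((p ^ k - 1) / (p - 1)) * inner ℝ (v i) x ^ p ^ k) • v i := by
  induction k, hk using Nat.le_induction with
  | base =>
    rw [geom_exponent_one hp]
    simp only [Function.iterate_one, toMap_sum, toMap_smul_tpow, pow_one]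
  | succ k hk ih =>
    rw [Function.iterate_succ_apply', ih]
    simp only [toMap_sum, toMap_smul_tpow]
    refine Finset.sum_congr rfl fun i _ => ?_
    rw [hv.inner_right_fintype, add_comm k, geom_exponent_add hp, geom_exponent_one hp]
    congr 1
    ring

theorem iter_sum_smul_tpow {ι : Type*} [Fintype ι] (hp : 2 ≤ p) (c : ι → ℝ) {v : ι → Vec n}
    (hv : Orthonormal ℝ v) {k : ℕ} (hk : 1 ≤ k) :
    iter (∑ i, c i • tpow (p + 1) (v i)) k
      = ∑ i, c i ^ ((p ^ k - 1) / (p - 1)) • tpow (p ^ k + 1) (v i) :=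
  iter_eq_of_toMap (IsSymm.sum fun i => (tpow_isSymm _).smul _).isPartSymm fun x => by
    simp only [iterate_sum_smul_tpow hp c hv hk, toMap_sum, toMap_smul_tpow]

theorem orthonormal_unit {v : Vec n} (hv : ‖v‖ = 1) : Orthonormal ℝ fun _ : Unit => v :=
  ⟨fun _ => hv, fun _ _ h => absurd (Subsingleton.elim _ _) h⟩

theorem iterate_smul_tpow (hp : 2 ≤ p) (a : ℝ) {v : Vec n} (hv : ‖v‖ = 1) {k : ℕ} (hk : 1 ≤ k)
    (x : Vec n) : (toMap (a • tpow (p + 1) v))^[k] x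
      = (a ^ ((p ^ k - 1) / (p - 1)) * inner ℝ v x ^ p ^ k) • v := by
  simpa using iterate_sum_smul_tpow hp (fun _ => a) (orthonormal_unit hv) hk x

theorem iter_smul_tpow (hp : 2 ≤ p) (a : ℝ) {v : Vec n} (hv : ‖v‖ = 1) {k : ℕ} (hk : 1 ≤ k) :
    iter (a • tpow (p + 1) v) k = a ^ ((p ^ k - 1) / (p - 1)) • tpow (p ^ k + 1) v := by
  simpa using iter_sum_smul_tpow hp (fun _ => a) (orthonormal_unit hv) hk

theorem toMap_iter_add (F : Tensor n (p + 1)) (k l : ℕ) (x : Vec n) :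
    toMap (iter F (k + l)) x = toMap (iter F k) (toMap (iter F l) x) := by
  simp only [toMap_iter, Function.iterate_add_apply]

theorem hsNorm_iter_add (F : Tensor n (p + 1)) (k l : ℕ) :
    hsNorm (iter F (k + l)) = hsNorm (comp (iter F k) (iter F l)) :=
  hsNorm_eq_of_toMap_eq (pow_add p k l) (isPartSymm_iter F _) (isPartSymm_comp _ _) fun x => by
    rw [toMap_iter_add, toMap_comp, Function.comp_apply]

theorem hsNorm_iter_add_le (F : Tensor n (p + 1)) (k l : ℕ) :
    hsNorm (iter F (k + l)) ≤ hsNorm (iter F k) * hsNorm (iter F l) ^ p ^ k :=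
  (hsNorm_iter_add F k l).trans_le (hsNorm_comp_le _ _)

theorem toMap_iter_one (F : Tensor n (p + 1)) (x : Vec n) : toMap (iter F 1) x = toMap F x := by
  rw [toMap_iter, Function.iterate_one]

theorem hsNorm_iter_one {F : Tensor n (p + 1)} (hF : IsPartSymm F) :
    hsNorm (iter F 1) = hsNorm F :=
  hsNorm_eq_of_toMap_eq (pow_one p) (isPartSymm_iter F _) hF (toMap_iter_one F)

theorem specNorm_iter_one {F : Tensor n (p + 1)} (hF : IsPartSymm F) :
    specNorm (iter F 1) = specNorm F :=
  specNorm_eq_of_toMap_eq (pow_one p) (isPartSymm_iter F _) hF (toMap_iter_one F)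

theorem eq_smul_tpow_of_iter_one_eq {F : Tensor n (p + 1)} (hF : IsPartSymm F) {b : ℝ} {v : Vec n}
    (h : iter F 1 = b • tpow (p ^ 1 + 1) v) : F = b • tpow (p + 1) v :=
  hF.ext_toMap (isPartSymm_smul_tpow b v) fun x => by
    rw [← toMap_iter_one, h, toMap_smul_tpow, toMap_smul_tpow, pow_one]

theorem hsNorm_zero {d : ℕ} : hsNorm (0 : Tensor n d) = 0 := hsNorm_eq_zero.2 rfl

/-- The equality case of the submultiplicativity of the Hilbert-Schmidt norm of iterates. -/
theorem hsNorm_iter_add_eq_iff (hp : 2 ≤ p) {F : Tensor n (p + 1)} (hF : IsPartSymm F)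
    (hr : ¬ ∃ (a : ℝ) (v : Vec n), a ≠ 0 ∧ ‖v‖ = 1 ∧ F = a • tpow (p + 1) v) {k l : ℕ}
    (hk : 1 ≤ k) (hl : 1 ≤ l) :
    hsNorm (iter F (k + l)) = hsNorm (iter F k) * hsNorm (iter F l) ^ (p ^ k) ↔
      iter F k = 0 ∨ iter F l = 0 ∨
      (2 ≤ min k l ∧ ∃ (v : Vec n) (b c : ℝ), ‖v‖ = 1 ∧
        iter F k = b • tpow (p ^ k + 1) v ∧
        iter F l = c • tpow (p ^ l + 1) v ∧
        b * c ^ (p ^ k) = c * b ^ (p ^ l)) := by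
  have hpk : p ^ k ≠ 0 := by positivity
  constructor
  · intro h
    by_cases hG : iter F k = 0
    · exact Or.inl hG
    by_cases hH : iter F l = 0
    · exact Or.inr (Or.inl hH)
    obtain ⟨v, b, c, hv, hb, hc, hb0, hc0, hbc⟩ :=
      exists_tpow_of_hsNorm_comp_eq (isPartSymm_iter F k) (isPartSymm_iter F l) hpk hH hG
        (fun x => by rw [← toMap_iter_add, ← toMap_iter_add, add_comm])
        ((hsNorm_iter_add F k l).symm.trans h)
    refine Or.inr (Or.inr ⟨?_, v, b, c, hv, hb, hc, hbc⟩)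
    -- A rank-one `iter F 1` would make `F` itself rank one, contrary to `hr`.
    have hk1 : k ≠ 1 := by
      rintro rfl
      exact hr ⟨b, v, hb0, hv, eq_smul_tpow_of_iter_one_eq hF hb⟩
    have hl1 : l ≠ 1 := by
      rintro rfl
      exact hr ⟨c, v, hc0, hv, eq_smul_tpow_of_iter_one_eq hF hc⟩
    omega
  · rintro (h | h | ⟨-, v, b, c, hv, hb, hc, -⟩)
    · refine le_antisymm (hsNorm_iter_add_le F k l) ?_
      rw [h, hsNorm_zero, zero_mul]
      exact hsNorm_nonneg _
    · refine le_antisymm (hsNorm_iter_add_le F k l) ?_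
      rw [h, hsNorm_zero, zero_pow hpk, mul_zero]
      exact hsNorm_nonneg _
    · have h1 : iter F (k + l) = (b * c ^ p ^ k) • tpow (p ^ (k + l) + 1) v := by
        refine iter_eq_of_toMap (isPartSymm_smul_tpow _ _) fun x => ?_
        rw [← toMap_iter, toMap_iter_add, hb, hc, toMap_smul_tpow, toMap_smul_tpow,
          toMap_smul_tpow, real_inner_smul_right, real_inner_self_eq_norm_sq, hv, pow_add]
        congr 1
        ring
      rw [h1, hb, hc]
      simp only [hsNorm_smul, hsNorm_tpow hv, mul_one, abs_mul, abs_pow]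

theorem specNorm_zero {d : ℕ} : specNorm (0 : Tensor n d) = 0 :=
  le_antisymm ((specNorm_le_hsNorm _).trans_eq hsNorm_zero) (specNorm_nonneg _)

section Spectral

variable [NeZero n]

theorem specNorm_iter_add_le (F : Tensor n (p + 1)) (k l : ℕ) :
    specNorm (iter F (k + l)) ≤ specNorm (iter F k) * specNorm (iter F l) ^ p ^ k := by
  obtain ⟨u, hu, hu'⟩ := (isPartSymm_iter F (k + l)).exists_specNorm_eq
  rw [← hu', toMap_iter_add]
  refine (norm_toMap_le_mul _ _).trans ?_
  gcongr
  · exact specNorm_nonneg _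
  · exact norm_toMap_le _ hu

/-- The equality case of the submultiplicativity of the spectral norm of iterates. -/
theorem specNorm_iter_add_eq_iff (hp : 1 ≤ p) (F : Tensor n (p + 1)) (k l : ℕ) :
    specNorm (iter F (k + l)) = specNorm (iter F k) * specNorm (iter F l) ^ (p ^ k) ↔
      iter F l = 0 ∨
      ∃ x : Vec n, ‖x‖ = 1 ∧ ‖(toMap F)^[l] x‖ = specNorm (iter F l) ∧
        ‖(toMap F)^[k] ((specNorm (iter F l))⁻¹ • (toMap F)^[l] x)‖ = specNorm (iter F k) := by
  have hpk : p ^ k ≠ 0 := by positivity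
  simp only [← toMap_iter]
  have hMl := specNorm_nonneg (iter F l)
  have hMk := specNorm_nonneg (iter F k)
  constructor
  · intro h
    rcases hMl.eq_or_lt with hl | hl
    · exact Or.inl ((isPartSymm_iter F l).eq_zero_of_specNorm_eq_zero hl.symm)
    right
    rcases hMk.eq_or_lt with hk | hk
    · obtain ⟨x, hx, hx'⟩ := (isPartSymm_iter F l).exists_specNorm_eq
      refine ⟨x, hx, hx', ?_⟩
      rw [(isPartSymm_iter F k).eq_zero_of_specNorm_eq_zero hk.symm, toMap_zero_tensor,
        norm_zero, specNorm_zero]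
    -- A maximizer for `iter F (k + l)` must make both inequalities in the proof of
    -- submultiplicativity sharp.
    obtain ⟨x, hx, hx'⟩ := (isPartSymm_iter F (k + l)).exists_specNorm_eq
    rw [h, toMap_iter_add] at hx'
    have h1 : ‖toMap (iter F l) x‖ = specNorm (iter F l) := by
      refine le_antisymm (norm_toMap_le _ hx) ?_
      have h2 := norm_toMap_le_mul (iter F k) (toMap (iter F l) x)
      rw [hx'] at h2
      exact (pow_le_pow_iff_left₀ hMl (norm_nonneg _) hpk).1 (le_of_mul_le_mul_left h2 hk)
    refine ⟨x, hx, h1, ?_⟩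
    rw [toMap_smul_vec, norm_smul, hx', norm_pow, norm_inv, Real.norm_of_nonneg hMl, inv_pow]
    field_simp
  · rintro (h | ⟨x, hx, h1, h2⟩)
    · refine le_antisymm (specNorm_iter_add_le F k l) ?_
      rw [h, specNorm_zero, zero_pow hpk, mul_zero]
      exact specNorm_nonneg _
    · refine le_antisymm (specNorm_iter_add_le F k l) ?_
      rcases hMl.eq_or_lt with hl | hl
      · rw [← hl, zero_pow hpk, mul_zero]
        exact specNorm_nonneg _
      rw [toMap_smul_vec, norm_smul, norm_pow, norm_inv, Real.norm_of_nonneg hMl, inv_pow] at h2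
      rw [← h2, ← toMap_iter_add]
      refine le_trans (le_of_eq ?_) (norm_toMap_le (iter F (k + l)) hx)
      field_simp

theorem IsSymm.pow_le_specNorm_iter (hp : 2 ≤ p) {F : Tensor n (p + 1)} (hF : IsSymm F) (k : ℕ) :
    specNorm F ^ ((p ^ k - 1) / (p - 1)) ≤ specNorm (iter F k) := by
  obtain ⟨u, hu, hu'⟩ := hF.exists_specNorm_eq
  -- Here `‖toMap F u‖ ≤ |form F u|` while `⟨u, toMap F u⟩ = form F u`: equality in Cauchy-Schwarz
  -- makes `u` an eigenvector.
  have h1 : toMap F u = form F u • u := by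
    have h2 := norm_toMap_le F hu
    rw [← hu'] at h2
    have h3 := pow_le_pow_left₀ (norm_nonneg _) h2 2
    have h4 := norm_sub_sq_real (toMap F u) (form F u • u)
    rw [inner_smul_right, real_inner_comm, inner_toMap_self, norm_smul, hu, mul_one,
      Real.norm_eq_abs, sq_abs] at h4
    rw [sq_abs] at h3
    have h5 : ‖toMap F u - form F u • u‖ ^ 2 ≤ 0 := by nlinarith
    exact sub_eq_zero.1 (norm_eq_zero.1 (pow_eq_zero_iff two_ne_zero |>.1
      (le_antisymm h5 (sq_nonneg _))))
  have h6 : ∀ k : ℕ, (toMap F)^[k] u = form F u ^ ((p ^ k - 1) / (p - 1)) • u := by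
    intro k
    induction k with
    | zero => simp
    | succ k ih =>
      rw [Function.iterate_succ_apply', ih, toMap_smul_vec, h1, smul_smul, add_comm k,
        geom_exponent_add hp, geom_exponent_one hp, pow_add, pow_one, ← pow_mul, mul_comm, pow_one, mul_comm p]
  have h7 := norm_toMap_le (iter F k) hu
  rw [toMap_iter, h6, norm_smul, hu, mul_one, norm_pow, Real.norm_eq_abs, hu'] at h7
  exact h7

end Spectral

/-- An orthogonally diagonalizable form is a combination of powers of orthonormal vectors. -/
theorem OrthDiag.exists_orthonormal {q : ℕ} {f : Vec n → ℝ} (h : OrthDiag q f) :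
    ∃ (v : Fin n → Vec n) (c : Fin n → ℝ), Orthonormal ℝ v ∧
      ∀ x, f x = ∑ i, c i * inner ℝ (v i) x ^ q := by
  obtain ⟨Q, hQ, c, hf⟩ := h
  have hQ1 : Q.transpose * Q = 1 := (Matrix.mem_orthogonalGroup_iff' (Fin n) ℝ).1 hQ
  have hQ2 : Q * Q.transpose = 1 := (Matrix.mem_orthogonalGroup_iff (Fin n) ℝ).1 hQ
  refine ⟨fun i => WithLp.toLp 2 fun j => Q j i, c, ?_, fun x => ?_⟩
  · rw [orthonormal_iff_ite]
    intro i j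
    have := congrFun (congrFun hQ1 i) j
    rw [Matrix.mul_apply, Matrix.one_apply] at this
    rw [← this, inner_eq_sum]
    rfl
  · have h1 : x = Matrix.toEuclideanLin Q (WithLp.toLp 2 (Q.transpose.mulVec x)) := by
      ext i
      simp [Matrix.toLpLin_apply, Matrix.mulVec_mulVec, hQ2]
    conv_lhs => rw [h1]
    rw [hf]
    refine Finset.sum_congr rfl fun i _ => ?_
    rw [inner_eq_sum]
    rfl

/-- The coefficients are `c i = f (v i)`, hence at most `specNorm F` in absolute value, and the
iterate is a sum of `n` orthogonal rank-one tensors. -/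
theorem hsSeq_le_of_orthDiag (hp : 2 ≤ p) [NeZero n] {F : Tensor n (p + 1)}
    (hF : IsSymm F) (h : OrthDiag (p + 1) (form F)) {k : ℕ} (hk : 1 ≤ k) :
    hsSeq F k ≤ (√n) ^ normExp p k * specNorm F := by
  obtain ⟨v, c, hv, hf⟩ := h.exists_orthonormal
  have hFv : F = ∑ i, c i • tpow (p + 1) (v i) := by
    refine hF.ext_form (IsSymm.sum fun i => (tpow_isSymm _).smul _) fun x => ?_
    rw [hf, form, pairing_sum]
    exact Finset.sum_congr rfl fun i _ => by rw [pairing_smul, ← form, form_tpow]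
  have hc : ∀ i, |c i| ≤ specNorm F := by
    intro i
    have h1 := abs_pairing_le_specNorm F fun _ => hv.1 i
    rw [← form, hf] at h1
    have h2 : ∑ j, c j * inner ℝ (v j) (v i) ^ (p + 1) = c i := by
      rw [Finset.sum_eq_single i]
      · simp [hv.1 i]
      · intro j _ hj
        simp [hv.2 hj]
      · simp
    rwa [h2] at h1
  have hM := specNorm_nonneg F
  have hle : hsNorm (iter F k) ≤ √n * specNorm F ^ ((p ^ k - 1) / (p - 1)) := by
    refine (sq_le_sq₀ (hsNorm_nonneg _) (by positivity)).1 ?_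
    conv_lhs => rw [hFv]
    rw [iter_sum_smul_tpow hp c hv hk, hsNorm_sum_tpow _ hv (Nat.succ_ne_zero _), mul_pow,
      Real.sq_sqrt (Nat.cast_nonneg n)]
    calc _ ≤ ∑ _i : Fin n, (specNorm F ^ ((p ^ k - 1) / (p - 1))) ^ 2 := by
          refine Finset.sum_le_sum fun i _ => ?_
          rw [← sq_abs, abs_pow]
          gcongr
          exact hc i
      _ = _ := by simp
  calc hsSeq F k ≤ (√n * specNorm F ^ ((p ^ k - 1) / (p - 1))) ^ normExp p k :=
        Real.rpow_le_rpow (hsNorm_nonneg _) hle (normExp_pos hp hk).le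
    _ = _ := by
        rw [Real.mul_rpow (Real.sqrt_nonneg _) (by positivity), pow_rpow_normExp hp hk hM]

end Iterates

end

end HomTensor

/-! ### Assembly of the main theorem. -/

theorem theorem3p3 (n p : ℕ) (hp : 2 ≤ p) (F : Tensor n (p + 1))
    (hF : IsPartSymm F) (hF0 : F ≠ 0) :
    -- the rank-one case; the natural-number quotient `(p ^ k - 1) / (p - 1)` is exact
    (∀ (a : ℝ) (v : Vec n), a ≠ 0 → ‖v‖ = 1 → F = a • tpow (p + 1) v → ∀ k : ℕ, 1 ≤ k →
      iter F k = a ^ ((p ^ k - 1) / (p - 1)) • tpow (p ^ k + 1) v ∧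
      hsNorm (iter F k) = |a| ^ ((p ^ k - 1) / (p - 1)) ∧
      (∀ x : Vec n, (toMap F)^[k] x =
        (a ^ ((p ^ k - 1) / (p - 1)) * (inner ℝ v x) ^ (p ^ k)) • v) ∧
      polyMapHS (p ^ k) (polyIter (polyMap F) k) = |a| ^ ((p ^ k - 1) / (p - 1))) ∧
    ∃ ρ₂ ρ₃ : ℝ,
      -- Hilbert-Schmidt norms
      ((∀ k : ℕ, 1 ≤ k → hsSeq F k ≤ hsNorm F) ∧
        (∀ k l : ℕ, 1 ≤ k → 1 ≤ l →
          hsNorm (iter F (k + l)) ≤ hsNorm (iter F k) * hsNorm (iter F l) ^ (p ^ k)) ∧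
        (∀ m : ℕ, 1 ≤ m → Antitone fun l : ℕ => hsSeq F (m * 2 ^ l)) ∧
        Tendsto (hsSeq F) atTop (𝓝 ρ₂) ∧
        ((¬ ∃ (a : ℝ) (v : Vec n), a ≠ 0 ∧ ‖v‖ = 1 ∧ F = a • tpow (p + 1) v) →
          ∀ k l : ℕ, 1 ≤ k → 1 ≤ l →
            (hsNorm (iter F (k + l)) = hsNorm (iter F k) * hsNorm (iter F l) ^ (p ^ k) ↔
              iter F k = 0 ∨ iter F l = 0 ∨
              (2 ≤ min k l ∧ ∃ (v : Vec n) (b c : ℝ), ‖v‖ = 1 ∧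
                iter F k = b • tpow (p ^ k + 1) v ∧
                iter F l = c • tpow (p ^ l + 1) v ∧
                b * c ^ (p ^ k) = c * b ^ (p ^ l))))) ∧
      -- spectral norms
      ((∀ k : ℕ, 1 ≤ k → specSeq F k ≤ specNorm F) ∧
        (∀ k l : ℕ, 1 ≤ k → 1 ≤ l →
          specNorm (iter F (k + l)) ≤ specNorm (iter F k) * specNorm (iter F l) ^ (p ^ k)) ∧
        (∀ m : ℕ, 1 ≤ m → Antitone fun l : ℕ => specSeq F (m * 2 ^ l)) ∧
        Tendsto (specSeq F) atTop (𝓝 ρ₃) ∧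
        ρ₃ ≤ ρ₂ ∧
        (∀ k l : ℕ, 1 ≤ k → 1 ≤ l →
          (specNorm (iter F (k + l)) = specNorm (iter F k) * specNorm (iter F l) ^ (p ^ k) ↔
            iter F l = 0 ∨
            ∃ x : Vec n, ‖x‖ = 1 ∧ ‖(toMap F)^[l] x‖ = specNorm (iter F l) ∧
              ‖(toMap F)^[k] ((specNorm (iter F l))⁻¹ • (toMap F)^[l] x)‖ =
                specNorm (iter F k)))) ∧
      -- symmetric tensors
      (IsSymm F →
        (∀ x : Vec n, HasGradientAt (form F) (((p : ℝ) + 1) • toMap F x) x) ∧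
        formNorm (form F) = specNorm F ∧
        specNorm F = ρ₃ ∧
        specNorm F ≤ ρ₂ ∧
        (OrthDiag (p + 1) (form F) → specNorm F = ρ₂)) := by
  -- For `n = 0` every tensor with at least one index vanishes.
  have hn : NeZero n := by
    refine ⟨?_⟩
    rintro rfl
    exact hF0 (funext fun i => (i 0).elim0)
  have hn0 : (0 : ℝ) < √n := Real.sqrt_pos.2 (by exact_mod_cast Nat.pos_of_ne_zero hn.out)
  have hhs := hsNorm_iter_add_le F
  have hspec := specNorm_iter_add_le F
  have hhs0 : ∀ k, 0 ≤ hsNorm (iter F k) := fun k => hsNorm_nonneg _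
  have hspec0 : ∀ k, 0 ≤ specNorm (iter F k) := fun k => specNorm_nonneg _
  obtain ⟨ρ₂, hρ₂⟩ := exists_tendsto_rpow_normExp hp hhs0 hhs
  obtain ⟨ρ₃, hρ₃⟩ := exists_tendsto_rpow_normExp hp hspec0 hspec
  replace hρ₂ : Tendsto (hsSeq F) atTop (𝓝 ρ₂) := hρ₂
  replace hρ₃ : Tendsto (specSeq F) atTop (𝓝 ρ₃) := hρ₃
  have hspecle : ∀ k : ℕ, 1 ≤ k → specSeq F k ≤ specNorm F := fun k hk =>
    (rpow_normExp_le hp hspec0 hspec hk).trans_eq (specNorm_iter_one hF)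
  have hρ : ρ₃ ≤ ρ₂ := by
    refine le_of_tendsto_of_tendsto hρ₃ hρ₂ ?_
    filter_upwards [eventually_ge_atTop 1] with k hk
    exact Real.rpow_le_rpow (hspec0 k) (specNorm_le_hsNorm _) (normExp_pos hp hk).le
  refine ⟨?_, ρ₂, ρ₃, ⟨?_, fun k l _ _ => hhs k l, fun m hm => rpow_normExp_antitone hp hhs0 hhs hm,
    hρ₂, fun hr k l hk hl => hsNorm_iter_add_eq_iff hp hF hr hk hl⟩,
    ⟨hspecle, fun k l _ _ => hspec k l, fun m hm => rpow_normExp_antitone hp hspec0 hspec hm,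
      hρ₃, hρ, fun k l _ _ => specNorm_iter_add_eq_iff (by omega) F k l⟩, fun hsymm => ?_⟩
  · rintro a v - hv rfl k hk
    have h := iter_smul_tpow hp a hv hk
    refine ⟨h, ?_, iterate_smul_tpow hp a hv hk, polyMapHS_polyIter_smul_tpow hp a hv hk⟩
    rw [h, hsNorm_smul, hsNorm_tpow hv, mul_one, abs_pow]
  · exact fun k hk => (rpow_normExp_le hp hhs0 hhs hk).trans_eq (hsNorm_iter_one hF)
  -- The eigenvector bound and `hspecle` together make `specSeq F k` equal to `specNorm F` for every
  -- `k ≥ 1`.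
  · have hM : specNorm F = ρ₃ := by
      refine tendsto_nhds_unique (tendsto_const_nhds.congr' ?_) hρ₃
      filter_upwards [eventually_ge_atTop 1] with k hk
      refine le_antisymm ?_ (hspecle k hk)
      rw [← pow_rpow_normExp hp hk (specNorm_nonneg F)]
      exact Real.rpow_le_rpow (pow_nonneg (specNorm_nonneg F) _) (hsymm.pow_le_specNorm_iter hp k)
        (normExp_pos hp hk).le
    refine ⟨hsymm.hasGradientAt_form, hsymm.formNorm_eq, hM, hM.trans_le hρ, fun hd => ?_⟩
    refine le_antisymm (hM.trans_le hρ) ?_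
    have hlim : Tendsto (fun k => (√n) ^ normExp p k * specNorm F) atTop (𝓝 (specNorm F)) := by
      simpa using (tendsto_const_rpow_normExp hp hn0).mul_const (specNorm F)
    refine le_of_tendsto_of_tendsto hρ₂ hlim ?_
    filter_upwards [eventually_ge_atTop 1] with k hk
    exact hsSeq_le_of_orthDiag hp hsymm hd hk
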